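/- Boolean values are $\{-1,1\}$ with $-1$ standing for TRUE, $|x|$ denotes the number of coordinates of $x\in\{-1,1\}^M$ equal to $-1$, and all logarithms are to base $2$. For $X\subseteq\{-1,1\}^M$ and $g\colon X\to\{-1,1\}$, let $\widetilde{\deg}(g)$ denote the least total degree of a real polynomial $p$ in $M$ variables with $|p(x)-g(x)|\le 1/3$ for all $x\in X$ (no condition is imposed on $p$ outside $X$). For $F\colon\{-1,1\}^a\to\{-1,1\}$ and $h\colon\{-1,1\}^b\to\{-1,1\}$, let $(F\circ h)(x_1,\dots,x_a)=F(h(x_1),\dots,h(x_a))$ for $x_i\in\{-1,1\}^b$. Theorem. There is a constant $c_0>0$ such that the following holds for every real $c\ge c_0$, every integer $n\ge 2$ and every function $f_n\colon\{-1,1\}^n\to\{-1,1\}$. Let $m=\lceil 10\log n\rceil$ and $N=\lceil c\, n\log^3 n\rceil$, and let $G^{\le N}$ be the restriction of $f_n\circ\mathsf{AND}_m\circ\mathsf{OR}_N$ to $\{x\in\{-1,1\}^{n m N} : |x|\le N\}$. Then $$\widetilde{\deg}(G^{\le N})\ \ge\ n^{1/3}\cdot\widetilde{\deg}(f_n)^{2/3}.$$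 -/

import Mathlib

/-! Boolean functions on `{-1,1}^ι`, where `{-1,1}` is modelled by `ℤˣ` and, as usual in this
convention, `-1` stands for TRUE and `1` for FALSE. -/

/-- The point of `ℝ^ι` given by a vector in `{-1,1}^ι`. -/
def realPoint {ι : Type*} (x : ι → ℤˣ) : ι → ℝ := fun i => ((x i : ℤ) : ℝ)

/-- `p` is an `ε`-approximating polynomial for the partial Boolean function `f` with domain
`X ⊆ {-1,1}^ι`: it is `ε`-close to `f` on `X`, and unrestricted outside `X`. -/
def IsApproxPoly {ι : Type*} {X : Set (ι → ℤˣ)} (ε : ℝ) (f : X → ℤˣ)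
    (p : MvPolynomial ι ℝ) : Prop :=
  ∀ x : X, |MvPolynomial.eval (realPoint x.1) p - ((f x : ℤ) : ℝ)| ≤ ε

/-- The `ε`-approximate degree of a partial Boolean function: the least total degree of a real
polynomial that `ε`-approximates it on its domain. -/
noncomputable def approxDegree {ι : Type*} {X : Set (ι → ℤˣ)} (ε : ℝ) (f : X → ℤˣ) : ℕ :=
  sInf {d : ℕ | ∃ p : MvPolynomial ι ℝ, p.totalDegree = d ∧ IsApproxPoly ε f p}

/-- On finitely many variables every partial Boolean function has an (even exact) polynomial
representation, so that the infimum defining `approxDegree` is a minimum. -/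
theorem exists_isApproxPoly {ι : Type*} [Fintype ι] {X : Set (ι → ℤˣ)} {ε : ℝ} (hε : 0 ≤ ε)
    (f : X → ℤˣ) :
    ∃ p : MvPolynomial ι ℝ, p.totalDegree = approxDegree ε f ∧ IsApproxPoly ε f p := by
  classical
  have key : ∃ p : MvPolynomial ι ℝ, IsApproxPoly ε f p := by
    refine ⟨∑ a : X, MvPolynomial.C (((f a : ℤ) : ℝ)) *
      ∏ i, (MvPolynomial.C (1 / 2 : ℝ) *
        (1 + MvPolynomial.C (((a.1 i : ℤ) : ℝ)) * MvPolynomial.X i)), fun x => ?_⟩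
    have h : ∀ a : X, ∏ i, ((1 / 2 : ℝ) * (1 + ((a.1 i : ℤ) : ℝ) * realPoint x.1 i))
        = if a = x then 1 else 0 := by
      intro a
      split_ifs with hax
      · subst hax
        refine Finset.prod_eq_one fun i _ => ?_
        rcases Int.units_eq_one_or (a.1 i) with h | h <;> simp [realPoint, h] <;> norm_num
      · obtain ⟨i, hi⟩ : ∃ i, a.1 i ≠ x.1 i := by
          by_contra hcon
          push Not at hcon
          exact hax (Subtype.ext (funext hcon))
        refine Finset.prod_eq_zero (Finset.mem_univ i) ?_
        rcases Int.units_eq_one_or (a.1 i) with h | h <;>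
          rcases Int.units_eq_one_or (x.1 i) with h' | h' <;> simp_all [realPoint]
    simp only [map_sum, map_mul, map_prod, map_add, map_one, MvPolynomial.eval_C,
      MvPolynomial.eval_X, h]
    simpa using hε
  obtain ⟨p, hp⟩ := key
  exact Nat.sInf_mem (s := {d : ℕ | ∃ p : MvPolynomial ι ℝ, p.totalDegree = d ∧
    IsApproxPoly ε f p}) ⟨_, p, rfl, hp⟩

/-- A total Boolean function, regarded as a partial function with domain all of `{-1,1}^ι`. -/
def onCube {ι : Type*} (f : (ι → ℤˣ) → ℤˣ) : ↥(Set.univ : Set (ι → ℤˣ)) → ℤˣ := fun x => f x.1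

/-- The Hamming weight `|x| = ∑ᵢ (1 - xᵢ)/2`, that is, the number of coordinates equal to `-1`. -/
def hammingWeight {ι : Type*} [Fintype ι] (x : ι → ℤˣ) : ℕ :=
  (Finset.univ.filter fun i => x i = -1).card

/-- `OR_N`: TRUE iff some input is TRUE. -/
def OR (N : ℕ) (x : Fin N → ℤˣ) : ℤˣ := if ∃ i, x i = -1 then -1 else 1

/-- `AND_m`: TRUE iff all inputs are TRUE. -/
def AND (m : ℕ) (x : Fin m → ℤˣ) : ℤˣ := if ∀ i, x i = -1 then -1 else 1

/-- The block composition `F ∘ h`, `(x₁, …, x_M) ↦ F (h x₁, …, h x_M)`. -/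
def blockComp {α β : Type*} (F : (α → ℤˣ) → ℤˣ) (h : (β → ℤˣ) → ℤˣ) : (α × β → ℤˣ) → ℤˣ :=
  fun x => F fun a => h fun b => x (a, b)

/-- The inputs in `{-1,1}^ι` of Hamming weight at most `k`. -/
def lowWeight (ι : Type*) [Fintype ι] (k : ℕ) : Set (ι → ℤˣ) := {x | hammingWeight x ≤ k}

/-- The partial function `G^{≤N}`: the restriction of `f ∘ AND_m ∘ OR_N` to inputs of Hamming
weight at most `N`. -/
def promiseComp {n : ℕ} (f : (Fin n → ℤˣ) → ℤˣ) (m N : ℕ) :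
    lowWeight ((Fin n × Fin m) × Fin N) N → ℤˣ :=
  fun x => blockComp (blockComp f (AND m)) (OR N) x.1

/-! ### Two distributions on `{0, …, 100 k²}` with equal low moments -/

/-! Let `p` of degree D approximate the promise function. Averaging `p` over suitable random inputs
turns it into an approximant of `f` of degree at most D/k.

There are distributions A, B on {-1,1}^N that agree on all characters of degree below k, although A
gives the all-FALSE point mass at least 2/5 and B gives it none (`exists_cube_distributions`). They
are the symmetric lifts of two distributions on weights with matching moments. Given z, draw
independently each OR block below the i-th input of `f`, from A if z_i is FALSE and from B if z_i is
TRUE. Under B all ORs are TRUE; under A all m of them are TRUE with probability at most (3/5)^m. So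
the inner functions return z up to a small error probability. The mean of `p` is a polynomial in z
of degree at most D/k, since z_i survives in the mean of a character only if that character has at
least k variables below i (`exists_blockAverage_poly`).

The product distribution also charges inputs of weight above N, where nothing is assumed about `p`.
Put T = 100k². Being bounded on weights up to D ≤ N, `p` is O((4T)^D e^{w/(2T)}) at weight w
(`abs_sum_cubeChar_le`), while the bounded mean weight of A and B gives E e^{w/T} ≤ e^{10nm/T} for
the whole input. Heavy inputs thus contribute O((4T)^D e^{-N/(2T)+10nm/T}), negligible once N is
large against nm and TD log T. The total error is at most 2/5, and reducing it to 1/3 triples the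
degree, so dk ≤ 3D with d the approximate degree of `f` (`approxDegree_mul_le`).

If D < n^{1/3}d^{2/3}, then k = ⌈3(n/d)^{1/3}⌉ keeps TD = O(n), so N of order n log n suffices; but
dk ≥ 3n^{1/3}d^{2/3} > 3D, a contradiction. -/

open Finset in
-- Each factor is (i-j)(i+j); together with i and (i-l-1)! these fill up the factorial (i+l)!.
theorem prod_sq_sub_sq_mul_factorial (i l : ℕ) (hl : l < i) :
    (∏ j ∈ Icc 1 l, |(j : ℝ) ^ 2 - (i : ℝ) ^ 2|) * (i * (i - l - 1).factorial)
      = ((i + l).factorial : ℝ) := by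
  induction l with
  | zero =>
    simp only [Order.lt_one_iff, Icc_eq_empty_of_lt, prod_empty, one_mul, Nat.sub_zero, add_zero]
    exact_mod_cast Nat.mul_factorial_pred (by omega)
  | succ l ih =>
    rw [prod_Icc_succ_top (by omega)]
    have ih := ih (by omega)
    obtain ⟨r, rfl⟩ : ∃ r, i = l + 2 + r := ⟨i - (l + 2), by omega⟩
    have e1 : l + 2 + r - l - 1 = r + 1 := by omega
    have e2 : l + 2 + r - (l + 1) - 1 = r := by omega
    have e3 : l + 2 + r + (l + 1) = (l + 2 + r + l) + 1 := by omega
    rw [e1, Nat.factorial_succ] at ih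
    rw [e2, e3, Nat.factorial_succ]
    have habs : |((l + 1 : ℕ) : ℝ) ^ 2 - ((l + 2 + r : ℕ) : ℝ) ^ 2|
        = ((r : ℝ) + 1) * (2 * l + 3 + r) := by
      rw [abs_of_nonpos]
      · push_cast; ring
      · push_cast; nlinarith [(Nat.cast_nonneg l : (0 : ℝ) ≤ l), (Nat.cast_nonneg r : (0 : ℝ) ≤ r)]
    rw [habs]
    push_cast at ih ⊢
    rw [← ih]
    ring

open Finset in
-- The indices j < i are covered by the previous lemma with l = i-1; each j > i contributes
-- (j-i)(j+i), extending both factorials by one factor.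
theorem prod_erase_sq_sub_sq (i k : ℕ) (hi : 1 ≤ i) (hik : i ≤ k) :
    (∏ j ∈ (Icc 1 k).erase i, |(j : ℝ) ^ 2 - (i : ℝ) ^ 2|) * (2 * (i : ℝ) ^ 2)
      = ((k - i).factorial : ℝ) * (k + i).factorial := by
  induction k, hik using Nat.le_induction with
  | base =>
    obtain ⟨l, rfl⟩ : ∃ l, i = l + 1 := ⟨i - 1, by omega⟩
    have h := prod_sq_sub_sq_mul_factorial (l + 1) l (by omega)
    have e : (Icc 1 (l + 1)).erase (l + 1) = Icc 1 l := by
      ext j; simp only [mem_erase, mem_Icc]; omega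
    rw [e]
    have e2 : l + 1 + (l + 1) = (l + 1 + l) + 1 := by omega
    rw [e2, Nat.factorial_succ, Nat.sub_self]
    have e3 : l + 1 - l - 1 = 0 := by omega
    rw [e3] at h
    push_cast at h ⊢
    rw [← h]
    simp
    ring
  | succ k hik ih =>
    have e : (Icc 1 (k + 1)).erase i = insert (k + 1) ((Icc 1 k).erase i) := by
      ext j; simp only [mem_erase, mem_Icc, mem_insert]; omega
    rw [e, prod_insert (by simp)]
    obtain ⟨r, rfl⟩ : ∃ r, k = i + r := ⟨k - i, by omega⟩
    have e1 : i + r + 1 - i = r + 1 := by omega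
    have e2 : i + r - i = r := by omega
    have e3 : i + r + 1 + i = (i + r + i) + 1 := by omega
    rw [e2] at ih
    rw [e1, e3, Nat.factorial_succ, Nat.factorial_succ]
    have habs : |((i + r + 1 : ℕ) : ℝ) ^ 2 - ((i : ℕ) : ℝ) ^ 2|
        = ((r : ℝ) + 1) * (2 * i + r + 1) := by
      rw [abs_of_nonneg]
      · push_cast; ring
      · push_cast; nlinarith [(Nat.cast_nonneg i : (0 : ℝ) ≤ i), (Nat.cast_nonneg r : (0 : ℝ) ≤ r)]
    rw [habs, mul_assoc, ih]
    push_cast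
    ring

/-- Equivalent to the maximality of the central binomial coefficient of 2k. -/
theorem factorial_sq_le (i k : ℕ) (hik : i ≤ k) :
    k.factorial ^ 2 ≤ (k - i).factorial * (k + i).factorial := by
  have h1 := Nat.choose_mul_factorial_mul_factorial (show k - i ≤ 2 * k by omega)
  have h2 := Nat.choose_mul_factorial_mul_factorial (show k ≤ 2 * k by omega)
  have e1 : 2 * k - (k - i) = k + i := by omega
  have e2 : 2 * k - k = k := by omega
  rw [e1] at h1
  rw [e2] at h2
  have h3 := Nat.choose_le_centralBinom (k - i) k
  rw [Nat.centralBinom] at h3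
  have hpos : 0 < (2 * k).choose k := Nat.choose_pos (by omega)
  refine Nat.le_of_mul_le_mul_left ?_ hpos
  calc (2 * k).choose k * k.factorial ^ 2 = (2 * k).factorial := by rw [← h2]; ring
    _ = (2 * k).choose (k - i) * ((k - i).factorial * (k + i).factorial) := by rw [← h1]; ring
    _ ≤ _ := Nat.mul_le_mul_right _ h3

open Finset in
-- The product equals 2·k!²/((k-i)!(k+i)!).
theorem prod_sq_div_sq_sub_sq_le (i k : ℕ) (hi : 1 ≤ i) (hik : i ≤ k) :
    ∏ j ∈ (Icc 1 k).erase i, |(j : ℝ) ^ 2 / ((j : ℝ) ^ 2 - (i : ℝ) ^ 2)| ≤ 2 := by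
  have h1 := prod_erase_sq_sub_sq i k hi hik
  have h2 : (∏ j ∈ (Icc 1 k).erase i, (j : ℝ) ^ 2) * (i : ℝ) ^ 2 = (k.factorial : ℝ) ^ 2 := by
    rw [prod_erase_mul _ _ (by simp; omega), prod_pow]
    congr 1
    rw [← prod_Ico_id_eq_factorial]
    push_cast
    rfl
  have h3 : ((k.factorial : ℝ)) ^ 2 ≤ ((k - i).factorial : ℝ) * (k + i).factorial := by
    exact_mod_cast factorial_sq_le i k hik
  have hi' : (0 : ℝ) < (i : ℝ) ^ 2 := by positivity
  simp_rw [abs_div, abs_of_nonneg (sq_nonneg ((_ : ℕ) : ℝ))]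
  rw [prod_div_distrib]
  have hpos : 0 < ∏ j ∈ (Icc 1 k).erase i, |(j : ℝ) ^ 2 - (i : ℝ) ^ 2| := by
    refine prod_pos fun j hj => abs_pos.mpr (sub_ne_zero.mpr ?_)
    rw [mem_erase] at hj
    intro h
    exact hj.1 (by exact_mod_cast (pow_left_inj₀ (by positivity) (by positivity) two_ne_zero).mp h)
  rw [div_le_iff₀ hpos]
  refine le_of_mul_le_mul_right ?_ hi'
  rw [h2]
  refine h3.trans (le_of_eq ?_)
  rw [← h1]
  ring

open Finset in
theorem sum_inv_sq_le (k : ℕ) : ∑ i ∈ Icc 1 k, ((i : ℝ) ^ 2)⁻¹ ≤ 2 := by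
  have h : ∀ k : ℕ, 1 ≤ k → ∑ i ∈ Icc 1 k, ((i : ℝ) ^ 2)⁻¹ ≤ 2 - (k : ℝ)⁻¹ := by
    intro k hk
    induction k, hk using Nat.le_induction with
    | base => norm_num
    | succ k hk ih =>
      rw [sum_Icc_succ_top (by omega)]
      have hk' : (0 : ℝ) < k := by exact_mod_cast hk
      have : (((k + 1 : ℕ) : ℝ) ^ 2)⁻¹ ≤ (k : ℝ)⁻¹ - ((k + 1 : ℕ) : ℝ)⁻¹ := by
        push_cast
        rw [inv_sub_inv (by positivity) (by positivity), inv_eq_one_div, div_le_div_iff₀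
          (by positivity) (by positivity)]
        nlinarith
      linarith
  rcases Nat.eq_zero_or_pos k with rfl | hk
  · simp
  · have := h k hk
    have h2 : (0 : ℝ) ≤ (k : ℝ)⁻¹ := by positivity
    linarith

/-- The interpolation nodes `1`, `2` and `100 i²` for `1 ≤ i ≤ k`. -/
def interpNodes (k : ℕ) : Finset ℕ :=
  insert 1 (insert 2 ((Finset.Icc 1 k).image fun i => 100 * i ^ 2))

/-- The coefficient of `P t` when `P 0` is interpolated from the values of `P` at `interpNodes k`. -/
noncomputable def interpCoeff (k t : ℕ) : ℝ :=
  ((Lagrange.basis (interpNodes k) (fun n : ℕ => (n : ℝ)) t).eval 0)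

open Finset in
theorem injOn_hundred_sq (k : ℕ) : Set.InjOn (fun i : ℕ => 100 * i ^ 2) (Icc 1 k : Finset ℕ) := by
  intro a _ b _ h
  have h' : a ^ 2 = b ^ 2 := by simpa using h
  exact (Nat.pow_left_injective two_ne_zero) h'

open Finset in
theorem two_notMem_image (k : ℕ) : 2 ∉ (Icc 1 k).image fun i => 100 * i ^ 2 := by
  simp only [mem_image, not_exists, not_and]
  intro a _ h
  omega

open Finset in
theorem one_notMem_insert_image (k : ℕ) :
    1 ∉ insert 2 ((Icc 1 k).image fun i => 100 * i ^ 2) := by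
  simp only [mem_insert, mem_image, not_or, not_exists, not_and]
  exact ⟨by norm_num, fun a _ h => by omega⟩

open Finset in
theorem card_interpNodes (k : ℕ) : #(interpNodes k) = k + 2 := by
  rw [interpNodes, card_insert_of_notMem (one_notMem_insert_image k),
    card_insert_of_notMem (two_notMem_image k), card_image_of_injOn (injOn_hundred_sq k)]
  simp

theorem sum_interpCoeff_mul (k : ℕ) (P : Polynomial ℝ) (hP : P.natDegree < k + 2) :
    ∑ t ∈ interpNodes k, interpCoeff k t * P.eval (t : ℝ) = P.eval 0 := by
  have h := Lagrange.eq_interpolate (s := interpNodes k) (v := fun n : ℕ => (n : ℝ))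
    (f := P) (Nat.cast_injective.injOn) (by
      rw [card_interpNodes]
      exact lt_of_le_of_lt Polynomial.degree_le_natDegree (by exact_mod_cast hP))
  conv_rhs => rw [h]
  rw [Lagrange.interpolate_apply, Polynomial.eval_finsetSum]
  refine Finset.sum_congr rfl fun t _ => ?_
  simp [interpCoeff, mul_comm]

open Finset in
theorem interpNodes_erase (k i : ℕ) (hi : i ∈ Icc 1 k) : (interpNodes k).erase (100 * i ^ 2) =
    insert 1 (insert 2 (((Icc 1 k).erase i).image fun i => 100 * i ^ 2)) := by
  rw [interpNodes, erase_insert_of_ne (by omega), erase_insert_of_ne (by omega)]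
  congr 2
  ext t
  simp only [mem_erase, mem_image]
  constructor
  · rintro ⟨h1, a, ha, rfl⟩
    exact ⟨a, ⟨fun h => h1 (by rw [h]), ha⟩, rfl⟩
  · rintro ⟨a, ⟨h1, ha⟩, rfl⟩
    exact ⟨fun h => h1 (injOn_hundred_sq k (by simpa using ha) (by simpa using hi) h), a, ha, rfl⟩

open Finset in
-- The other square nodes contribute a factor at most 2, and each of the nodes 1 and 2 a further
-- O(i⁻²). This i⁻⁴ decay is why those two nodes are added: it keeps the mean, where the coefficient
-- is multiplied by 100i², bounded in k.
theorem abs_interpCoeff_le (k i : ℕ) (hi : i ∈ Icc 1 k) :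
    |interpCoeff k (100 * i ^ 2)| ≤ 1 / (1000 * ((i : ℝ) ^ 2) ^ 2) := by
  have hi1 : 1 ≤ i := (mem_Icc.mp hi).1
  have hi1' : (1 : ℝ) ≤ (i : ℝ) ^ 2 := by
    have : (1 : ℝ) ≤ i := by exact_mod_cast hi1
    nlinarith
  rw [interpCoeff, Lagrange.basis, interpNodes_erase k i hi]
  have hs : (((Icc 1 k).erase i).image fun i => 100 * i ^ 2) ⊆
      (Icc 1 k).image fun i => 100 * i ^ 2 := image_subset_image (erase_subset _ _)
  rw [prod_insert (fun h => one_notMem_insert_image k (insert_subset_insert _ hs h)),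
    prod_insert (fun h => two_notMem_image k (hs h)),
    prod_image (fun a ha b hb h => injOn_hundred_sq k (by simp at ha ⊢; omega)
      (by simp at hb ⊢; omega) h)]
  simp only [Lagrange.basisDivisor, Polynomial.eval_mul, Polynomial.eval_prod, Polynomial.eval_C,
    Polynomial.eval_sub, Polynomial.eval_X, abs_mul, abs_prod]
  have h1 : ∀ j ∈ (Icc 1 k).erase i, |(((100 * i ^ 2 : ℕ) : ℝ) - ((100 * j ^ 2 : ℕ) : ℝ))⁻¹| *
      |0 - ((100 * j ^ 2 : ℕ) : ℝ)| = |(j : ℝ) ^ 2 / ((j : ℝ) ^ 2 - (i : ℝ) ^ 2)| := by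
    intro j _
    rw [← abs_mul]
    congr 1
    push_cast
    rw [show (100 : ℝ) * i ^ 2 - 100 * j ^ 2 = -(100 * (j ^ 2 - i ^ 2)) by ring, inv_neg, mul_inv,
      div_eq_mul_inv]
    ring
  rw [prod_congr rfl h1]
  have h2 := prod_sq_div_sq_sub_sq_le i k hi1 (mem_Icc.mp hi).2
  push_cast
  have h3 : |((100 : ℝ) * i ^ 2 - 1)⁻¹| * |(0 : ℝ) - 1| ≤ 1 / (50 * (i : ℝ) ^ 2) := by
    rw [abs_of_pos (by rw [inv_pos]; linarith), zero_sub, abs_neg, abs_one, mul_one, one_div]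
    exact inv_anti₀ (by linarith) (by linarith)
  have h4 : |((100 : ℝ) * i ^ 2 - 2)⁻¹| * |(0 : ℝ) - 2| ≤ 1 / (80 * (i : ℝ) ^ 2) * 2 := by
    rw [abs_of_pos (by rw [inv_pos]; linarith), zero_sub, abs_neg, abs_two, one_div]
    exact mul_le_mul_of_nonneg_right (inv_anti₀ (by linarith) (by linarith)) (by norm_num)
  calc _ ≤ 1 / (50 * (i : ℝ) ^ 2) * ((1 / (80 * (i : ℝ) ^ 2) * 2) * 2) := by
        gcongr
    _ = 1 / (1000 * ((i : ℝ) ^ 2) ^ 2) := by field_simp; norm_num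

/-- `interpCoeff k`, extended by zero outside the set of nodes. -/
noncomputable def interpWeight (k t : ℕ) : ℝ := if t ∈ interpNodes k then interpCoeff k t else 0

open Finset in
theorem interpNodes_subset (k : ℕ) (hk : 1 ≤ k) : interpNodes k ⊆ range (100 * k ^ 2 + 1) := by
  have hk2 : 1 ≤ k ^ 2 := Nat.one_le_pow _ _ hk
  intro t ht
  simp only [interpNodes, mem_insert, mem_image, mem_Icc] at ht
  rw [mem_range]
  rcases ht with rfl | rfl | ⟨i, hi, rfl⟩
  · omega
  · omega
  · have := Nat.pow_le_pow_left hi.2 2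
    omega

open Finset in
theorem sum_interpWeight_mul (k : ℕ) (hk : 1 ≤ k) (g : ℕ → ℝ) :
    ∑ t ∈ range (100 * k ^ 2 + 1), |interpWeight k t| * g t
      = |interpCoeff k 1| * g 1 + (|interpCoeff k 2| * g 2 +
        ∑ i ∈ Icc 1 k, |interpCoeff k (100 * i ^ 2)| * g (100 * i ^ 2)) := by
  rw [← sum_subset (interpNodes_subset k hk) (fun t _ ht => by simp [interpWeight, ht]),
    sum_congr rfl (g := fun t => |interpCoeff k t| * g t)
      (fun t ht => by simp [interpWeight, ht]), interpNodes,
    sum_insert (one_notMem_insert_image k), sum_insert (two_notMem_image k),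
    sum_image (injOn_hundred_sq k)]

open Finset in
theorem sum_interpWeight_mul_eval (k : ℕ) (hk : 1 ≤ k) (P : Polynomial ℝ)
    (hP : P.natDegree < k + 2) :
    ∑ t ∈ range (100 * k ^ 2 + 1), interpWeight k t * P.eval (t : ℝ) = P.eval 0 := by
  rw [← sum_interpCoeff_mul k P hP,
    ← sum_subset (interpNodes_subset k hk) (fun t _ ht => by simp [interpWeight, ht])]
  exact sum_congr rfl (fun t ht => by simp [interpWeight, ht])

open Finset in
-- Exactness for the polynomials 1 and X gives two linear equations for the coefficients at 1 and 2.
-- Without the square nodes the solution is 2 and -1; these nodes perturb the equations by at most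
-- 0.002 and 0.2.
theorem interpCoeff_bounds (k : ℕ) :
    (0 ≤ interpCoeff k 1 ∧ interpCoeff k 1 ≤ 2.21) ∧ |interpCoeff k 2| ≤ 1.21 ∧
      ∑ i ∈ Icc 1 k, |interpCoeff k (100 * i ^ 2)| ≤ 0.002 ∧
      ∑ i ∈ Icc 1 k, |interpCoeff k (100 * i ^ 2)| * ((100 * i ^ 2 : ℕ) : ℝ) ≤ 0.2 := by
  have hE1 : ∑ i ∈ Icc 1 k, |interpCoeff k (100 * i ^ 2)| * ((100 * i ^ 2 : ℕ) : ℝ) ≤ 0.2 := by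
    calc _ ≤ ∑ i ∈ Icc 1 k, 0.1 * ((i : ℝ) ^ 2)⁻¹ := by
          refine sum_le_sum fun i hi => ?_
          have h0 : (0 : ℝ) < i := by exact_mod_cast (mem_Icc.mp hi).1
          refine (mul_le_mul_of_nonneg_right (abs_interpCoeff_le k i hi) (by positivity)).trans
            (le_of_eq ?_)
          push_cast
          field_simp
          norm_num
      _ ≤ _ := by
          rw [← mul_sum]
          linarith [sum_inv_sq_le k]
  have hE0 : ∑ i ∈ Icc 1 k, |interpCoeff k (100 * i ^ 2)| ≤ 0.002 := by
    have : ∑ i ∈ Icc 1 k, |interpCoeff k (100 * i ^ 2)| * 100 ≤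
        ∑ i ∈ Icc 1 k, |interpCoeff k (100 * i ^ 2)| * ((100 * i ^ 2 : ℕ) : ℝ) := by
      refine sum_le_sum fun i hi => mul_le_mul_of_nonneg_left ?_ (abs_nonneg _)
      have : 1 ≤ i ^ 2 := Nat.one_le_pow _ _ (mem_Icc.mp hi).1
      exact_mod_cast (by omega : 100 ≤ 100 * i ^ 2)
    rw [← sum_mul] at this
    linarith
  have h0 := sum_interpCoeff_mul k 1 (by simp)
  have h1 := sum_interpCoeff_mul k Polynomial.X (by simp)
  rw [interpNodes, sum_insert (one_notMem_insert_image k), sum_insert (two_notMem_image k),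
    sum_image (injOn_hundred_sq k)] at h0 h1
  simp only [Polynomial.eval_one, mul_one, Polynomial.eval_X] at h0 h1
  have hA0 : |∑ i ∈ Icc 1 k, interpCoeff k (100 * i ^ 2)| ≤ 0.002 :=
    (abs_sum_le_sum_abs _ _).trans hE0
  have hA1 : |∑ i ∈ Icc 1 k, interpCoeff k (100 * i ^ 2) * ((100 * i ^ 2 : ℕ) : ℝ)| ≤ 0.2 := by
    refine (abs_sum_le_sum_abs _ _).trans (le_trans (le_of_eq ?_) hE1)
    refine sum_congr rfl fun i _ => ?_
    rw [abs_mul, Nat.abs_cast]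
  rw [abs_le] at hA0 hA1
  push_cast at h1 hA1
  refine ⟨⟨by linarith, by linarith⟩, abs_le.mpr ⟨by linarith, by linarith⟩, hE0, hE1⟩

open Finset in
/-- Two probability distributions on `{0, …, 100 k²}` of bounded mean whose moments of order less
than `k` agree, although only the first one charges `0`. -/
theorem exists_moment_matching (k : ℕ) (hk : 1 ≤ k) :
    ∃ α β : ℕ → ℝ, (∀ t, 0 ≤ α t) ∧ (∀ t, 0 ≤ β t) ∧
      ∑ t ∈ range (100 * k ^ 2 + 1), α t = 1 ∧ ∑ t ∈ range (100 * k ^ 2 + 1), β t = 1 ∧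
      2 / 5 ≤ α 0 ∧ β 0 = 0 ∧
      ∑ t ∈ range (100 * k ^ 2 + 1), α t * t ≤ 5 ∧ ∑ t ∈ range (100 * k ^ 2 + 1), β t * t ≤ 5 ∧
      ∀ P : Polynomial ℝ, P.natDegree < k →
        ∑ t ∈ range (100 * k ^ 2 + 1), α t * P.eval (t : ℝ)
          = ∑ t ∈ range (100 * k ^ 2 + 1), β t * P.eval (t : ℝ) := by
  obtain ⟨⟨hL1, hL1'⟩, hL2, hE0, hE1⟩ := interpCoeff_bounds k
  set R := range (100 * k ^ 2 + 1) with hR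
  set c := interpWeight k with hc
  have h0S : 0 ∉ interpNodes k := by
    simp only [interpNodes, mem_insert, mem_image, mem_Icc, not_or, not_exists, not_and]
    refine ⟨by norm_num, by norm_num, fun i hi h => ?_⟩
    have : 1 ≤ i ^ 2 := Nat.one_le_pow _ _ hi.1
    omega
  have h1S : 1 ∈ interpNodes k := by simp [interpNodes]
  have hc0 : c 0 = 0 := by simp [hc, interpWeight, h0S]
  have hc1 : max (-c 1) 0 = 0 := by simp [hc, interpWeight, h1S, hL1]
  have hmean : ∑ t ∈ R, |c t| * t ≤ 5 := by
    have := sum_interpWeight_mul k hk (fun t => (t : ℝ))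
    rw [← hR, ← hc] at this
    rw [this, abs_of_nonneg hL1]
    push_cast at hE1 ⊢
    linarith
  have hneg : ∑ t ∈ R, max (-c t) 0 ≤ 1.3 := by
    have := sum_interpWeight_mul k hk (fun t => if t = 1 then 0 else 1)
    rw [← hR, ← hc] at this
    calc _ ≤ ∑ t ∈ R, |c t| * (if t = 1 then 0 else 1) := by
          refine sum_le_sum fun t _ => ?_
          split_ifs with h
          · rw [h, hc1]; simp
          · rw [mul_one]; exact max_le (neg_le_abs _) (abs_nonneg _)
      _ = |interpCoeff k 2| + ∑ i ∈ Icc 1 k, |interpCoeff k (100 * i ^ 2)| := by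
          rw [this]
          simp only [if_true, mul_zero, zero_add]
          congr 1
          · norm_num
          · refine sum_congr rfl fun i _ => ?_
            rw [if_neg (by omega), mul_one]
      _ ≤ _ := by linarith
  -- M ≤ 2.3, because the large coefficient at node 1 is nonnegative; hence the mass 1/M at 0 is at
  -- least 2/5.
  set M := 1 + ∑ t ∈ R, max (-c t) 0 with hM
  have hM1 : 1 ≤ M := by
    have : 0 ≤ ∑ t ∈ R, max (-c t) 0 := sum_nonneg fun t _ => le_max_right _ _
    linarith
  have hM0 : 0 < M := by linarith
  have h0R : 0 ∈ R := by simp [hR]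
  have hδ : ∀ g : ℕ → ℝ, ∑ t ∈ R, (if t = 0 then 1 else 0) * g t = g 0 := by
    intro g
    simp [h0R]
  have hdec : ∀ t, max (c t) 0 = c t + max (-c t) 0 := by
    intro t
    rcases le_total 0 (c t) with h | h
    · rw [max_eq_left h, max_eq_right (by linarith)]; ring
    · rw [max_eq_right h, max_eq_left (by linarith)]; ring
  have hmatch : ∀ P : Polynomial ℝ, P.natDegree < k + 2 →
      ∑ t ∈ R, (((if t = 0 then 1 else 0) + max (-c t) 0) / M) * P.eval (t : ℝ)
        = ∑ t ∈ R, (max (c t) 0 / M) * P.eval (t : ℝ) := by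
    intro P hP
    have h1 := sum_interpWeight_mul_eval k hk P hP
    rw [← hR, ← hc] at h1
    have h2 := hδ (fun t => P.eval (t : ℝ))
    simp_rw [div_mul_eq_mul_div, ← sum_div, hdec, add_mul, sum_add_distrib]
    rw [h1, h2]
    simp
  have hsumα : ∑ t ∈ R, ((if t = 0 then 1 else 0) + max (-c t) 0) / M = 1 := by
    rw [← sum_div, sum_add_distrib, div_eq_one_iff_eq hM0.ne', hM]
    have := hδ (fun _ => 1)
    simp only [mul_one] at this
    rw [this]
  -- The identity P(0) = Σ c_t P(t), with negative terms moved to the left and both sides normalised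
  -- by their common mass M.
  refine ⟨fun t => ((if t = 0 then 1 else 0) + max (-c t) 0) / M, fun t => max (c t) 0 / M,
    fun t => ?_, fun t => ?_, hsumα, ?_, ?_, ?_, ?_, ?_, fun P hP => hmatch P (by omega)⟩
  · have : (0 : ℝ) ≤ if t = 0 then 1 else 0 := by split_ifs <;> norm_num
    have := le_max_right (-c t) 0
    positivity
  · have := le_max_right (c t) 0
    positivity
  · have := hmatch 1 (by simp)
    simp only [Polynomial.eval_one, mul_one] at this
    rw [← this, hsumα]
  · simp only [if_true, hc0]
    rw [div_le_div_iff₀ (by norm_num) hM0]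
    norm_num
    linarith
  · simp [hc0]
  · refine le_trans (sum_le_sum fun t _ => ?_) hmean
    by_cases ht : t = 0
    · simp [ht]
    · simp only [ht, if_false, zero_add]
      gcongr
      exact (div_le_self (le_max_right _ _) hM1).trans (max_le (neg_le_abs _) (abs_nonneg _))
  · refine le_trans (sum_le_sum fun t _ => ?_) hmean
    gcongr
    exact (div_le_self (le_max_right _ _) hM1).trans (max_le (le_abs_self _) (abs_nonneg _))

/-! ### Characters and symmetric averages on the cube -/

/-- The character `χ_U(x) = ∏_{b ∈ U} x_b`. -/
def cubeChar {ι : Type*} (U : Finset ι) (x : ι → ℤˣ) : ℝ := ∏ b ∈ U, realPoint x b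

/-- The point of the cube whose set of `-1` coordinates is `s`. -/
def signVec {ι : Type*} [DecidableEq ι] (s : Finset ι) : ι → ℤˣ := fun i => if i ∈ s then -1 else 1

/-- Subsets of `ι` correspond to points of the cube. -/
def signEquiv (ι : Type*) [DecidableEq ι] [Fintype ι] : Finset ι ≃ (ι → ℤˣ) where
  toFun := signVec
  invFun x := Finset.univ.filter fun i => x i = -1
  left_inv s := by
    ext i
    by_cases h : i ∈ s <;> simp [signVec, h]
  right_inv x := by
    funext i
    rcases Int.units_eq_one_or (x i) with h | h <;> simp [signVec, h]

theorem hammingWeight_signVec {ι : Type*} [DecidableEq ι] [Fintype ι] (s : Finset ι) :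
    hammingWeight (signVec s) = s.card := by
  rw [hammingWeight]
  congr 1
  ext i
  by_cases h : i ∈ s <;> simp [signVec, h]

theorem sum_signVec {ι : Type*} [DecidableEq ι] [Fintype ι] (g : (ι → ℤˣ) → ℝ) :
    ∑ x, g x = ∑ s : Finset ι, g (signVec s) :=
  ((signEquiv ι).sum_comp g).symm

theorem exists_signVec {ι : Type*} [DecidableEq ι] [Fintype ι] (x : ι → ℤˣ) :
    ∃ s : Finset ι, signVec s = x := (signEquiv ι).surjective x

open Finset in
theorem cubeChar_signVec {ι : Type*} [DecidableEq ι] (U s : Finset ι) :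
    cubeChar U (signVec s) = ∑ W ∈ U.powerset, if W ⊆ s then (-2 : ℝ) ^ #W else 0 := by
  have h : ∀ b, realPoint (signVec s) b = 1 + if b ∈ s then (-2 : ℝ) else 0 := by
    intro b
    by_cases hb : b ∈ s <;> simp [realPoint, signVec, hb]
    norm_num
  simp_rw [cubeChar, h, prod_one_add]
  refine sum_congr rfl fun W _ => ?_
  split_ifs with hW
  · rw [prod_congr rfl (fun b hb => if_pos (hW hb)), prod_const]
  · obtain ⟨b, hb, hbs⟩ := not_subset.mp hW
    exact prod_eq_zero hb (if_neg hbs)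

open Finset in
theorem card_filter_subset_powersetCard {ι : Type*} [DecidableEq ι] [Fintype ι] (W : Finset ι)
    (t : ℕ) (hW : #W ≤ t) :
    #{s ∈ powersetCard t (univ : Finset ι) | W ⊆ s}
      = (Fintype.card ι - #W).choose (t - #W) := by
  rw [← card_compl, ← card_powersetCard]
  refine card_bij' (fun s _ => s \ W) (fun s _ => s ∪ W) ?_ ?_ ?_ ?_
  · intro s hs
    simp only [mem_filter, mem_powersetCard, subset_univ, true_and] at hs ⊢
    refine ⟨fun b hb => by simp at hb ⊢; exact hb.2, ?_⟩
    rw [card_sdiff_of_subset hs.2, hs.1]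
  · intro s hs
    simp only [mem_filter, mem_powersetCard, subset_univ, true_and] at hs ⊢
    refine ⟨?_, subset_union_right⟩
    rw [card_union_of_disjoint (disjoint_left.mpr fun b hb => mem_compl.mp (hs.1 hb)), hs.2]
    omega
  · intro s hs
    simp only [mem_filter] at hs
    exact sdiff_union_of_subset hs.2
  · intro s hs
    simp only [mem_powersetCard] at hs
    exact union_sdiff_cancel_right (disjoint_left.mpr fun b hb => mem_compl.mp (hs.1 hb))

open Finset in
/-- The average of `F` over the points of Hamming weight `t`. -/
noncomputable def layerAvg {ι : Type*} [DecidableEq ι] [Fintype ι] (F : (ι → ℤˣ) → ℝ) (t : ℕ) : ℝ :=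
  (∑ s ∈ powersetCard t (univ : Finset ι), F (signVec s)) / (Fintype.card ι).choose t

open Finset in
theorem layerAvg_weight {ι : Type*} [DecidableEq ι] [Fintype ι] (g : ℕ → ℝ) (t : ℕ)
    (ht : t ≤ Fintype.card ι) : layerAvg (fun x : ι → ℤˣ => g (hammingWeight x)) t = g t := by
  have hpos : (0 : ℝ) < (Fintype.card ι).choose t := by exact_mod_cast Nat.choose_pos ht
  rw [layerAvg, div_eq_iff hpos.ne', sum_congr rfl (g := fun _ => g t), sum_const,
    card_powersetCard, nsmul_eq_mul, mul_comm]
  · rfl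
  · intro s hs
    rw [hammingWeight_signVec, (mem_powersetCard.mp hs).2]

open Finset in
/-- The average of a character over the layer of weight `t` is a polynomial in `t`. -/
theorem exists_layerAvg_cubeChar {ι : Type*} [DecidableEq ι] [Fintype ι] (U : Finset ι) :
    ∃ P : Polynomial ℝ, P.natDegree ≤ #U ∧
      ∀ t : ℕ, t ≤ Fintype.card ι → layerAvg (cubeChar U) t = P.eval (t : ℝ) := by
  -- The indicator of W ⊆ s has layer average C(t,|W|)/C(|ι|,|W|), a polynomial of degree |W| in t.
  refine ⟨∑ W ∈ U.powerset, Polynomial.C ((-2 : ℝ) ^ #W / ((#W).factorial *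
    (Fintype.card ι).choose #W)) * descPochhammer ℝ #W, ?_, fun t ht => ?_⟩
  · refine Polynomial.natDegree_sum_le_of_forall_le _ _ fun W hW => ?_
    refine (Polynomial.natDegree_C_mul_le _ _).trans ?_
    rw [descPochhammer_natDegree]
    exact card_le_card (mem_powerset.mp hW)
  · have hpos : (0 : ℝ) < (Fintype.card ι).choose t := by exact_mod_cast Nat.choose_pos ht
    rw [layerAvg, div_eq_iff hpos.ne', Polynomial.eval_finsetSum, sum_mul]
    simp_rw [cubeChar_signVec]
    rw [sum_comm]
    refine sum_congr rfl fun W _ => ?_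
    rw [← sum_filter, sum_const, nsmul_eq_mul, Polynomial.eval_mul, Polynomial.eval_C,
      descPochhammer_eval_eq_descFactorial, Nat.descFactorial_eq_factorial_mul_choose]
    have hWc : (0 : ℝ) < (Fintype.card ι).choose #W := by
      exact_mod_cast Nat.choose_pos (card_le_univ W)
    have hf : (0 : ℝ) < (#W).factorial := by exact_mod_cast Nat.factorial_pos _
    rcases le_or_gt #W t with hWt | hWt
    · rw [card_filter_subset_powersetCard W t hWt]
      have h := Nat.choose_mul (n := Fintype.card ι) (k := t) (s := #W) hWt
      have h' : ((Fintype.card ι).choose t : ℝ) * t.choose #W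
          = (Fintype.card ι).choose #W * (Fintype.card ι - #W).choose (t - #W) := by
        exact_mod_cast h
      push_cast
      field_simp
      linear_combination -h'
    · rw [Nat.choose_eq_zero_of_lt hWt, filter_false_of_mem]
      · simp
      · intro s hs hsub
        have := card_le_card hsub
        rw [(mem_powersetCard.mp hs).2] at this
        omega

/-- The distribution on the cube whose Hamming weight has distribution `α` restricted to
`{0, …, T}` and which is uniform on layers. -/
noncomputable def layerLift {ι : Type*} [Fintype ι] (T : ℕ) (α : ℕ → ℝ) (x : ι → ℤˣ) : ℝ :=
  if hammingWeight x ≤ T then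
    α (hammingWeight x) / (Fintype.card ι).choose (hammingWeight x) else 0

open Finset in
theorem sum_layerLift {ι : Type*} [DecidableEq ι] [Fintype ι] (T : ℕ) (hT : T ≤ Fintype.card ι)
    (α : ℕ → ℝ) (F : (ι → ℤˣ) → ℝ) :
    ∑ x, layerLift T α x * F x = ∑ t ∈ range (T + 1), α t * layerAvg F t := by
  rw [sum_signVec, ← powerset_univ, sum_powerset, card_univ,
    ← sum_subset (range_subset_range.mpr (Nat.succ_le_succ hT))]
  · refine sum_congr rfl fun t ht => ?_
    rw [layerAvg, sum_div, mul_sum]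
    refine sum_congr rfl fun s hs => ?_
    have hst : #s = t := (mem_powersetCard.mp hs).2
    rw [layerLift, hammingWeight_signVec, hst, if_pos (Nat.lt_succ_iff.mp (mem_range.mp ht))]
    ring
  · intro t _ ht
    refine sum_eq_zero fun s hs => ?_
    have hst : #s = t := (mem_powersetCard.mp hs).2
    rw [layerLift, hammingWeight_signVec, hst, if_neg, zero_mul]
    rw [mem_range] at ht
    omega

open Finset in
-- Since e^u ≤ 1 + 2u on [0,1], only the mean enters. The exponential form of the bound multiplies
-- over independent blocks.
theorem sum_mul_exp_le (T : ℕ) (hT : 0 < T) (α : ℕ → ℝ) (h0 : ∀ t, 0 ≤ α t)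
    (h1 : ∑ t ∈ range (T + 1), α t = 1) (hm : ∑ t ∈ range (T + 1), α t * t ≤ 5) :
    ∑ t ∈ range (T + 1), α t * Real.exp ((t : ℝ) / T) ≤ Real.exp (10 / T) := by
  have hT' : (0 : ℝ) < T := by exact_mod_cast hT
  calc _ ≤ ∑ t ∈ range (T + 1), (α t + 2 / T * (α t * t)) := by
        refine sum_le_sum fun t ht => ?_
        have htT : (t : ℝ) / T ≤ 1 := by
          rw [div_le_one hT']
          exact_mod_cast Nat.lt_succ_iff.mp (mem_range.mp ht)
        have ht0 : 0 ≤ (t : ℝ) / T := by positivity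
        have := Real.abs_exp_sub_one_sub_id_le (x := (t : ℝ) / T) (by rwa [abs_of_nonneg ht0])
        have h2 := (abs_le.mp this).2
        have h3 : Real.exp ((t : ℝ) / T) ≤ 1 + 2 * ((t : ℝ) / T) := by nlinarith
        calc _ ≤ α t * (1 + 2 * ((t : ℝ) / T)) := mul_le_mul_of_nonneg_left h3 (h0 t)
          _ = _ := by ring
    _ = 1 + 2 / T * ∑ t ∈ range (T + 1), α t * t := by rw [sum_add_distrib, h1, mul_sum]
    _ ≤ 1 + 2 / T * 5 := by gcongr
    _ = 10 / T + 1 := by ring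
    _ ≤ _ := Real.add_one_le_exp _

open Finset in
/-- Two distributions on the cube that agree on low-degree characters; the second never draws the
all-`1` point, and the first does so with constant probability. -/
theorem exists_cube_distributions (k N : ℕ) (hk : 1 ≤ k) (hN : 100 * k ^ 2 ≤ N) :
    ∃ A B : (Fin N → ℤˣ) → ℝ, (∀ x, 0 ≤ A x) ∧ (∀ x, 0 ≤ B x) ∧ ∑ x, A x = 1 ∧ ∑ x, B x = 1 ∧
      2 / 5 ≤ A 1 ∧ B 1 = 0 ∧
      ∑ x, A x * Real.exp ((hammingWeight x : ℝ) / (100 * k ^ 2 : ℕ))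
        ≤ Real.exp (10 / (100 * k ^ 2 : ℕ)) ∧
      ∑ x, B x * Real.exp ((hammingWeight x : ℝ) / (100 * k ^ 2 : ℕ))
        ≤ Real.exp (10 / (100 * k ^ 2 : ℕ)) ∧
      ∀ U : Finset (Fin N), #U < k → ∑ x, A x * cubeChar U x = ∑ x, B x * cubeChar U x := by
  obtain ⟨α, β, hα, hβ, hα1, hβ1, hα0, hβ0, hαm, hβm, hmatch⟩ := exists_moment_matching k hk
  set T := 100 * k ^ 2 with hTdef
  have hT : 0 < T := by positivity
  have hcard : T ≤ Fintype.card (Fin N) := by simpa using hN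
  have hw1 : hammingWeight (1 : Fin N → ℤˣ) = 0 := by
    rw [hammingWeight, card_eq_zero, filter_eq_empty_iff]
    intro i _
    simp
  have hone : ∀ γ : ℕ → ℝ, layerLift T γ (1 : Fin N → ℤˣ) = γ 0 := by
    intro γ
    simp [layerLift, hw1]
  have hsym : ∀ (γ g : ℕ → ℝ), ∑ x : Fin N → ℤˣ, layerLift T γ x * g (hammingWeight x)
      = ∑ t ∈ range (T + 1), γ t * g t := by
    intro γ g
    rw [sum_layerLift T hcard γ (fun x => g (hammingWeight x))]
    refine sum_congr rfl fun t ht => ?_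
    rw [layerAvg_weight]
    exact (Nat.lt_succ_iff.mp (mem_range.mp ht)).trans hcard
  have htot : ∀ γ : ℕ → ℝ, ∑ x : Fin N → ℤˣ, layerLift T γ x = ∑ t ∈ range (T + 1), γ t := by
    intro γ
    simpa using hsym γ (fun _ => 1)
  have hnn : ∀ γ : ℕ → ℝ, (∀ t, 0 ≤ γ t) → ∀ x : Fin N → ℤˣ, 0 ≤ layerLift T γ x := by
    intro γ hγ x
    rw [layerLift]
    split_ifs
    · exact div_nonneg (hγ _) (Nat.cast_nonneg _)
    · exact le_rfl
  refine ⟨layerLift T α, layerLift T β, hnn α hα, hnn β hβ, by rw [htot, hα1], by rw [htot, hβ1],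
    by rw [hone]; exact hα0, by rw [hone]; exact hβ0, ?_, ?_, fun U hU => ?_⟩
  · rw [hsym α (fun t => Real.exp ((t : ℝ) / T))]
    exact sum_mul_exp_le T hT α hα hα1 hαm
  · rw [hsym β (fun t => Real.exp ((t : ℝ) / T))]
    exact sum_mul_exp_le T hT β hβ hβ1 hβm
  · obtain ⟨P, hP, hPt⟩ := exists_layerAvg_cubeChar U
    rw [sum_layerLift T hcard, sum_layerLift T hcard]
    have h : ∀ γ : ℕ → ℝ, ∑ t ∈ range (T + 1), γ t * layerAvg (cubeChar U) t
        = ∑ t ∈ range (T + 1), γ t * P.eval (t : ℝ) := by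
      intro γ
      refine sum_congr rfl fun t ht => ?_
      rw [hPt t ((Nat.lt_succ_iff.mp (mem_range.mp ht)).trans hcard)]
    rw [h, h]
    exact hmatch P (hP.trans_lt hU)

/-! ### Multilinear expansions and the growth of bounded low-degree polynomials -/

open Finset in
/-- On the cube every polynomial agrees with a combination of characters of no larger degree. -/
theorem exists_eval_eq_sum_cubeChar {ι : Type*} [DecidableEq ι] [Fintype ι]
    (p : MvPolynomial ι ℝ) :
    ∃ c : Finset ι → ℝ, (∀ V, p.totalDegree < #V → c V = 0) ∧
      ∀ x : ι → ℤˣ, MvPolynomial.eval (realPoint x) p = ∑ V, c V * cubeChar V x := by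
  -- On the cube x² = 1, so only the parity of each exponent matters.
  let o : (ι →₀ ℕ) → Finset ι := fun e => univ.filter fun i => Odd (e i)
  refine ⟨fun V => ∑ e ∈ p.support with o e = V, p.coeff e, fun V hV => ?_, fun x => ?_⟩
  · refine sum_eq_zero fun e he => ?_
    exfalso
    rw [mem_filter] at he
    have h1 : #(o e) ≤ e.sum fun _ n => n := by
      rw [Finsupp.sum_fintype _ _ (fun _ => rfl), card_eq_sum_ones]
      refine (sum_le_sum fun i hi => ?_).trans (sum_le_sum_of_subset (subset_univ _))
      exact (mem_filter.mp hi).2.pos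
    have h2 := MvPolynomial.le_totalDegree he.1
    rw [he.2] at h1
    omega
  · have hmon : ∀ e : ι →₀ ℕ, ∏ i, realPoint x i ^ e i = cubeChar (o e) x := by
      intro e
      rw [cubeChar, prod_filter]
      refine prod_congr rfl fun i _ => ?_
      have hx : realPoint x i ^ 2 = 1 := by
        rcases Int.units_eq_one_or (x i) with h | h <;> simp [realPoint, h]
      rcases Nat.even_or_odd (e i) with h | h
      · rw [if_neg (Nat.not_odd_iff_even.mpr h)]
        obtain ⟨r, hr⟩ := h
        rw [hr, ← two_mul, pow_mul, hx, one_pow]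
      · rw [if_pos h]
        obtain ⟨r, hr⟩ := h
        rw [hr, pow_succ, pow_mul, hx, one_pow, one_mul]
    rw [MvPolynomial.eval_eq']
    simp_rw [hmon, sum_mul]
    rw [← sum_fiberwise p.support o]
    refine sum_congr rfl fun V _ => sum_congr rfl fun e he => ?_
    rw [(mem_filter.mp he).2]

open Finset in
theorem sum_powerset_neg_one_pow_mul_cubeChar {ι : Type*} [DecidableEq ι] (V W : Finset ι) :
    ∑ U ∈ W.powerset, (-1 : ℝ) ^ #U * cubeChar V (signVec U)
      = if W ⊆ V then (2 : ℝ) ^ #W else 0 := by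
  have h : ∀ U : Finset ι, (-1 : ℝ) ^ #U * cubeChar V (signVec U)
      = ∏ b ∈ U, if b ∈ V then (1 : ℝ) else -1 := by
    intro U
    have h1 : cubeChar V (signVec U) = ∏ b ∈ U, if b ∈ V then (-1 : ℝ) else 1 := by
      have h2 : ∀ b, realPoint (signVec U) b = if b ∈ U then (-1 : ℝ) else 1 := by
        intro b
        by_cases hb : b ∈ U <;> simp [realPoint, signVec, hb]
      simp_rw [cubeChar, h2]
      rw [← prod_filter, ← prod_filter, filter_mem_eq_inter, filter_mem_eq_inter, inter_comm]
    rw [h1, ← prod_const, ← prod_mul_distrib]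
    refine prod_congr rfl fun b _ => ?_
    split_ifs <;> norm_num
  simp_rw [h]
  rw [← prod_one_add]
  split_ifs with hW
  · rw [prod_congr rfl (g := fun _ => (2 : ℝ)), prod_const]
    intro b hb
    rw [if_pos (hW hb)]
    norm_num
  · obtain ⟨b, hb, hbV⟩ := not_subset.mp hW
    exact prod_eq_zero hb (by rw [if_neg hbV]; norm_num)

open Finset in
/-- A polynomial of degree `D` that is bounded on the points of weight at most `D` grows only
moderately with the weight. -/
theorem abs_sum_cubeChar_le {ι : Type*} [DecidableEq ι] [Fintype ι] (c : Finset ι → ℝ) (D : ℕ)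
    (hc : ∀ V, D < #V → c V = 0) (K : ℝ)
    (hK : ∀ x : ι → ℤˣ, hammingWeight x ≤ D → |∑ V, c V * cubeChar V x| ≤ K) (y : ℝ) (hy : 0 < y)
    (hy1 : y ≤ 1) (x : ι → ℤˣ) :
    |∑ V, c V * cubeChar V x| ≤ K * (y⁻¹ ^ D * (1 + 2 * y) ^ hammingWeight x) := by
  have hK0 : 0 ≤ K := by
    refine (abs_nonneg _).trans (hK (signVec ∅) ?_)
    rw [hammingWeight_signVec]
    simp
  obtain ⟨s, rfl⟩ := exists_signVec x
  rw [hammingWeight_signVec]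
  set a : Finset ι → ℝ := fun W => ∑ V, if W ⊆ V then c V else 0 with ha
  have hexp : ∑ V, c V * cubeChar V (signVec s) = ∑ W ∈ s.powerset, (-2 : ℝ) ^ #W * a W := by
    have h1 : ∀ V : Finset ι, cubeChar V (signVec s)
        = ∑ W ∈ s.powerset, if W ⊆ V then (-2 : ℝ) ^ #W else 0 := by
      intro V
      rw [cubeChar_signVec, ← sum_filter, ← sum_filter]
      refine sum_congr ?_ fun _ _ => rfl
      ext W
      simp [and_comm]
    simp_rw [h1, ha, mul_sum]
    rw [sum_comm]
    refine sum_congr rfl fun W _ => sum_congr rfl fun V _ => ?_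
    split_ifs <;> ring
  -- Möbius inversion: up to sign, the coefficient of the monomial W is an alternating sum of values
  -- at subsets of W. For |W| ≤ D all these points lie where the bound K holds.
  have hinv : ∀ W, (2 : ℝ) ^ #W * a W
      = ∑ U ∈ W.powerset, (-1 : ℝ) ^ #U * ∑ V, c V * cubeChar V (signVec U) := by
    intro W
    simp_rw [mul_sum]
    rw [sum_comm, ha, mul_sum]
    refine sum_congr rfl fun V _ => ?_
    have := sum_powerset_neg_one_pow_mul_cubeChar V W
    calc _ = c V * (if W ⊆ V then (2 : ℝ) ^ #W else 0) := by split_ifs <;> ring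
      _ = _ := by
        rw [← this, mul_sum]
        exact sum_congr rfl fun U _ => by ring
  have hbound : ∀ W, |(2 : ℝ) ^ #W * a W| ≤ K * (y⁻¹ ^ D * (2 * y) ^ #W) := by
    intro W
    rcases le_or_gt #W D with hW | hW
    · have h1 : |(2 : ℝ) ^ #W * a W| ≤ 2 ^ #W * K := by
        rw [hinv]
        refine (abs_sum_le_sum_abs _ _).trans ?_
        calc _ ≤ ∑ U ∈ W.powerset, K := by
              refine sum_le_sum fun U hU => ?_
              rw [abs_mul, abs_pow, abs_neg, abs_one, one_pow, one_mul]
              refine hK _ ?_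
              rw [hammingWeight_signVec]
              exact (card_le_card (mem_powerset.mp hU)).trans hW
          _ = _ := by rw [sum_const, card_powerset, nsmul_eq_mul]; push_cast; rfl
      refine h1.trans ?_
      -- This factor replaces the cutoff |W| ≤ D, so that the sum over all W ⊆ s becomes a binomial
      -- expansion.
      have h2 : (1 : ℝ) ≤ y⁻¹ ^ D * y ^ #W := by
        obtain ⟨r, hr⟩ := Nat.exists_eq_add_of_le hW
        rw [hr, pow_add, mul_right_comm, ← mul_pow, inv_mul_cancel₀ hy.ne', one_pow, one_mul]
        exact one_le_pow₀ ((one_le_inv₀ hy).mpr hy1)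
      calc (2 : ℝ) ^ #W * K ≤ 2 ^ #W * K * (y⁻¹ ^ D * y ^ #W) :=
            le_mul_of_one_le_right (by positivity) h2
        _ = _ := by rw [mul_pow]; ring
    · have : a W = 0 := by
        refine sum_eq_zero fun V _ => ?_
        split_ifs with h
        · exact hc V (hW.trans_le (card_le_card h))
        · rfl
      rw [this, mul_zero, abs_zero]
      positivity
  rw [hexp]
  refine (abs_sum_le_sum_abs _ _).trans ?_
  calc _ ≤ ∑ W ∈ s.powerset, K * (y⁻¹ ^ D * (2 * y) ^ #W) := by
        refine sum_le_sum fun W _ => ?_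
        refine le_trans (le_of_eq ?_) (hbound W)
        simp [abs_mul, abs_pow]
    _ = _ := by
        rw [← mul_sum, ← mul_sum]
        congr 2
        rw [← prod_const, prod_one_add]
        simp

/-! ### Averaging over independent blocks -/

open Finset in
theorem sum_prod_blocks {α β : Type*} [DecidableEq α] [Fintype α] [DecidableEq β] [Fintype β]
    (g : α → (β → ℤˣ) → ℝ) :
    ∑ x : α × β → ℤˣ, ∏ a, g a (fun b => x (a, b)) = ∏ a, ∑ y, g a y := by
  rw [prod_univ_sum, Fintype.piFinset_univ]
  exact Fintype.sum_equiv (Equiv.curry α β ℤˣ) _ _ fun x => rfl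

/-- The part of `V` in block `a`. -/
def blockPart {α β : Type*} [DecidableEq α] [DecidableEq β] [Fintype β] (V : Finset (α × β))
    (a : α) : Finset β := Finset.univ.filter fun b => (a, b) ∈ V

open Finset in
theorem cubeChar_eq_prod_blockPart {α β : Type*} [DecidableEq α] [Fintype α] [DecidableEq β]
    [Fintype β] (V : Finset (α × β)) (x : α × β → ℤˣ) :
    cubeChar V x = ∏ a, cubeChar (blockPart V a) (fun b => x (a, b)) := by
  have h : cubeChar V x = ∏ e, if e ∈ V then realPoint x e else 1 := by
    rw [cubeChar, prod_ite_mem, univ_inter]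
  rw [h, Fintype.prod_prod_type]
  refine prod_congr rfl fun a _ => ?_
  rw [cubeChar, blockPart, prod_filter]
  rfl

open Finset in
theorem card_eq_sum_blockPart {α β : Type*} [DecidableEq α] [Fintype α] [DecidableEq β]
    [Fintype β] (V : Finset (α × β)) : #V = ∑ a, #(blockPart V a) := by
  have h : #V = ∑ e, if e ∈ V then 1 else 0 := by simp
  rw [h, Fintype.sum_prod_type]
  refine sum_congr rfl fun a _ => ?_
  rw [blockPart, card_filter]

open Finset in
theorem hammingWeight_eq_sum_blocks {α β : Type*} [Fintype α] [Fintype β] (x : α × β → ℤˣ) :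
    hammingWeight x = ∑ a, hammingWeight fun b => x (a, b) := by
  rw [hammingWeight, card_filter, Fintype.sum_prod_type]
  refine sum_congr rfl fun a _ => ?_
  rw [hammingWeight, card_filter]

/-- The product over the blocks of distributions chosen according to the signs `z`. -/
noncomputable def blockDist {n m N : ℕ} (μ : ℤˣ → (Fin N → ℤˣ) → ℝ) (z : Fin n → ℤˣ)
    (x : (Fin n × Fin m) × Fin N → ℤˣ) : ℝ :=
  ∏ a : Fin n × Fin m, μ (z a.1) fun b => x (a, b)

open Finset in
theorem sum_blockDist_mul_prod {n m N : ℕ} (μ : ℤˣ → (Fin N → ℤˣ) → ℝ) (z : Fin n → ℤˣ)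
    (g : Fin n × Fin m → (Fin N → ℤˣ) → ℝ) :
    ∑ x : (Fin n × Fin m) × Fin N → ℤˣ, blockDist μ z x * ∏ a, g a (fun b => x (a, b))
      = ∏ a : Fin n × Fin m, ∑ y, μ (z a.1) y * g a y := by
  rw [← sum_prod_blocks fun (a : Fin n × Fin m) y => μ (z a.1) y * g a y]
  refine sum_congr rfl fun x _ => ?_
  rw [blockDist, ← prod_mul_distrib]

open Finset in
/-- If the two block distributions agree on characters of degree less than `k`, then averaging a
polynomial of degree `D` over the blocks yields a polynomial of degree at most `D / k` in `z`. -/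
theorem exists_blockAverage_poly {n m N k D : ℕ} (hk : 1 ≤ k) (μ : ℤˣ → (Fin N → ℤˣ) → ℝ)
    (hμ : ∀ U : Finset (Fin N), #U < k →
      ∑ y, μ 1 y * cubeChar U y = ∑ y, μ (-1) y * cubeChar U y)
    (c : Finset ((Fin n × Fin m) × Fin N) → ℝ) (hc : ∀ V, D < #V → c V = 0) :
    ∃ r : MvPolynomial (Fin n) ℝ, r.totalDegree * k ≤ D ∧
      ∀ z : Fin n → ℤˣ, MvPolynomial.eval (realPoint z) r
        = ∑ x, blockDist μ z x * ∑ V, c V * cubeChar V x := by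
  set M : ℤˣ → Finset (Fin N) → ℝ := fun s U => ∑ y, μ s y * cubeChar U y with hM
  set g : Finset ((Fin n × Fin m) × Fin N) → Fin n → ℤˣ → ℝ :=
    fun V i s => ∏ j : Fin m, M s (blockPart V (i, j)) with hg
  -- The mean of a character factors over i, and a function of one sign z_i is affine in z_i.
  refine ⟨∑ V, MvPolynomial.C (c V) * ∏ i, (MvPolynomial.C ((g V i 1 + g V i (-1)) / 2)
    + MvPolynomial.C ((g V i 1 - g V i (-1)) / 2) * MvPolynomial.X i), ?_, fun z => ?_⟩
  · rw [← Nat.le_div_iff_mul_le (by omega)]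
    refine MvPolynomial.totalDegree_finsetSum_le fun V _ => ?_
    rcases lt_or_ge D #V with hV | hV
    · rw [hc V hV]
      simp
    refine (MvPolynomial.totalDegree_mul _ _).trans ?_
    rw [MvPolynomial.totalDegree_C, zero_add]
    refine (MvPolynomial.totalDegree_finsetProd _ _).trans ?_
    rw [Nat.le_div_iff_mul_le (by omega), sum_mul]
    refine le_trans ?_ hV
    rw [card_eq_sum_blockPart V, Fintype.sum_prod_type]
    refine sum_le_sum fun i _ => ?_
    -- Either V spends at least k of its at most D elements below i, or the two distributions give
    -- the same factor and z_i drops out.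
    by_cases hi : ∃ j, k ≤ #(blockPart V (i, j))
    · obtain ⟨j, hj⟩ := hi
      have h1 : k ≤ ∑ j, #(blockPart V (i, j)) :=
        hj.trans (single_le_sum (f := fun j => #(blockPart V (i, j)))
          (fun _ _ => Nat.zero_le _) (mem_univ j))
      refine le_trans ?_ h1
      refine (Nat.mul_le_mul_right k (?_ : _ ≤ 1)).trans (by simp)
      refine (MvPolynomial.totalDegree_add _ _).trans (max_le ?_ ?_)
      · simp
      · refine (MvPolynomial.totalDegree_mul _ _).trans ?_
        simp
    · push Not at hi
      have : g V i 1 = g V i (-1) := prod_congr rfl fun j _ => hμ _ (hi j)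
      rw [this]
      simp
  · have h1 : ∀ V, ∑ x : (Fin n × Fin m) × Fin N → ℤˣ, blockDist μ z x * cubeChar V x
        = ∏ i, g V i (z i) := by
      intro V
      simp_rw [cubeChar_eq_prod_blockPart V]
      rw [sum_blockDist_mul_prod μ z fun a y => cubeChar (blockPart V a) y,
        Fintype.prod_prod_type]
    have h2 : ∀ V i, (g V i 1 + g V i (-1)) / 2 + (g V i 1 - g V i (-1)) / 2 * realPoint z i
        = g V i (z i) := by
      intro V i
      rcases Int.units_eq_one_or (z i) with h | h <;> simp only [realPoint, h] <;> push_cast <;>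
        ring
    simp only [map_sum, map_mul, map_prod, map_add, MvPolynomial.eval_C, MvPolynomial.eval_X, h2]
    simp_rw [mul_sum]
    rw [sum_comm]
    refine sum_congr rfl fun V _ => ?_
    rw [← h1 V, mul_sum]
    exact sum_congr rfl fun x _ => by ring

open Finset in
theorem sum_blockDist {n m N : ℕ} (μ : ℤˣ → (Fin N → ℤˣ) → ℝ) (hμ : ∀ s, ∑ y, μ s y = 1)
    (z : Fin n → ℤˣ) : ∑ x : (Fin n × Fin m) × Fin N → ℤˣ, blockDist μ z x = 1 := by
  have := sum_blockDist_mul_prod (m := m) μ z fun _ _ => 1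
  simpa [hμ] using this

open Finset in
theorem sum_blockDist_mul_exp_le {n m N : ℕ} (μ : ℤˣ → (Fin N → ℤˣ) → ℝ) (hμ0 : ∀ s y, 0 ≤ μ s y)
    (T K : ℝ) (hμ : ∀ s, ∑ y, μ s y * Real.exp ((hammingWeight y : ℝ) / T) ≤ Real.exp K)
    (z : Fin n → ℤˣ) :
    ∑ x : (Fin n × Fin m) × Fin N → ℤˣ, blockDist μ z x * Real.exp ((hammingWeight x : ℝ) / T)
      ≤ Real.exp (n * m * K) := by
  have h1 : ∀ x : (Fin n × Fin m) × Fin N → ℤˣ, Real.exp ((hammingWeight x : ℝ) / T)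
      = ∏ a, Real.exp ((hammingWeight (fun b => x (a, b)) : ℝ) / T) := by
    intro x
    rw [← Real.exp_sum, hammingWeight_eq_sum_blocks, Nat.cast_sum, sum_div]
  simp_rw [h1]
  rw [sum_blockDist_mul_prod μ z fun _ y => Real.exp ((hammingWeight y : ℝ) / T)]
  refine (prod_le_prod (fun a _ => sum_nonneg fun y _ =>
    mul_nonneg (hμ0 _ _) (Real.exp_pos _).le) fun a _ => hμ (z a.1)).trans (le_of_eq ?_)
  rw [prod_const, ← Real.exp_nat_mul]
  simp

/-- The outer inputs of `f ∘ AND_m ∘ OR_N` computed from `x`. -/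
def innerValue {n m N : ℕ} (x : (Fin n × Fin m) × Fin N → ℤˣ) (i : Fin n) : ℤˣ :=
  AND m fun j => OR N fun b => x ((i, j), b)

open Finset in
/-- Under `blockDist` an inner value differs from the prescribed sign with exponentially small
probability. -/
theorem sum_blockDist_innerValue_ne_le {n m N : ℕ} (μ : ℤˣ → (Fin N → ℤˣ) → ℝ)
    (hμ0 : ∀ s y, 0 ≤ μ s y) (hμ : ∀ s, ∑ y, μ s y = 1) (hA : 2 / 5 ≤ μ 1 1) (hB : μ (-1) 1 = 0)
    (z : Fin n → ℤˣ) (i : Fin n) :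
    ∑ x : (Fin n × Fin m) × Fin N → ℤˣ, blockDist μ z x * (if innerValue x i ≠ z i then 1 else 0)
      ≤ (3 / 5 : ℝ) ^ m := by
  have hone : ∀ (x : (Fin n × Fin m) × Fin N → ℤˣ) (j : Fin m),
      (fun b => x ((i, j), b)) = 1 ↔ OR N (fun b => x ((i, j), b)) ≠ -1 := by
    intro x j
    constructor
    · intro h
      rw [h]
      simp [OR]
    · intro h
      funext b
      rcases Int.units_eq_one_or (x ((i, j), b)) with hb | hb
      · exact hb
      · exact absurd (by rw [OR, if_pos ⟨b, hb⟩]) h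
  rcases Int.units_eq_one_or (z i) with hz | hz
  -- For z_i FALSE an error forces every one of the m blocks to avoid the all-`1` point, an event
  -- that factors over the blocks.
  · have h1 : ∀ x : (Fin n × Fin m) × Fin N → ℤˣ,
        blockDist μ z x * (if innerValue x i ≠ z i then 1 else 0)
          ≤ blockDist μ z x * ∏ a : Fin n × Fin m,
            (fun (a : Fin n × Fin m) (y : Fin N → ℤˣ) =>
              if a.1 = i ∧ y = 1 then (0 : ℝ) else 1) a (fun b => x (a, b)) := by
      intro x
      refine mul_le_mul_of_nonneg_left ?_ (prod_nonneg fun a _ => hμ0 _ _)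
      split_ifs with h
      · refine le_of_eq (prod_eq_one fun a _ => if_neg ?_).symm
        rintro ⟨ha, h1⟩
        obtain ⟨i', j⟩ := a
        obtain rfl : i' = i := ha
        refine h ?_
        rw [hz, innerValue, AND, if_neg]
        exact fun hall => (hone x j).mp h1 (hall j)
      · exact prod_nonneg fun a _ => by dsimp only; split_ifs <;> norm_num
    refine (sum_le_sum fun x _ => h1 x).trans ?_
    rw [sum_blockDist_mul_prod μ z fun (a : Fin n × Fin m) (y : Fin N → ℤˣ) =>
      if a.1 = i ∧ y = 1 then (0 : ℝ) else 1, Fintype.prod_prod_type]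
    calc _ ≤ ∏ i' : Fin n, (if i' = i then (3 / 5 : ℝ) ^ m else 1) := by
          refine prod_le_prod (fun i' _ => prod_nonneg fun j _ => sum_nonneg fun y _ =>
            mul_nonneg (hμ0 _ _) (by split_ifs <;> norm_num)) fun i' _ => ?_
          split_ifs with hi
          · subst hi
            have h2 : ∑ y : Fin N → ℤˣ, μ (z i') y * (if i' = i' ∧ y = 1 then (0 : ℝ) else 1)
                ≤ 3 / 5 := by
              have h3 : ∀ y : Fin N → ℤˣ, μ (z i') y * (if i' = i' ∧ y = 1 then (0 : ℝ) else 1)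
                  = μ 1 y - if y = 1 then μ 1 1 else 0 := by
                intro y
                by_cases hy : y = 1 <;> simp [hy, hz]
              rw [sum_congr rfl fun y _ => h3 y, sum_sub_distrib, hμ, sum_ite_eq' univ]
              simp only [mem_univ, if_true]
              linarith
            refine (prod_le_prod (fun j _ => sum_nonneg fun y _ =>
              mul_nonneg (hμ0 _ _) (by split_ifs <;> norm_num)) fun j _ => h2).trans ?_
            rw [prod_const, card_univ, Fintype.card_fin]
          · simp [hi, hμ]
      _ = _ := by simp
  · refine le_trans (le_of_eq (sum_eq_zero fun x _ => ?_)) (by positivity)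
    split_ifs with h
    · rw [mul_one]
      have : ∃ j, OR N (fun b => x ((i, j), b)) ≠ -1 := by
        by_contra hcon
        push Not at hcon
        exact h (by rw [hz, innerValue, AND, if_pos hcon])
      obtain ⟨j, hj⟩ := this
      refine prod_eq_zero (mem_univ (i, j)) ?_
      rw [(hone x j).mpr hj, hz, hB]
    · rw [mul_zero]

theorem abs_units_cast (s : ℤˣ) : |((s : ℤ) : ℝ)| = 1 := by
  rcases Int.units_eq_one_or s with h | h <;> simp [h]

open Finset in
-- The three terms pay for the approximation error, for a wrong inner value and for weight w > N. In
-- the last case growth e^{w/(2T)} is at most e^{-N/(2T)}e^{w/T}, which makes the exponential moment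
-- applicable.
theorem abs_eval_sub_le {n m N D T : ℕ} (hT : 0 < T) (hDN : D ≤ N) (f : (Fin n → ℤˣ) → ℤˣ)
    (c : Finset ((Fin n × Fin m) × Fin N) → ℝ) (hc : ∀ V, D < #V → c V = 0)
    (hf : ∀ x : (Fin n × Fin m) × Fin N → ℤˣ, hammingWeight x ≤ N →
      |∑ V, c V * cubeChar V x - ((f (innerValue x) : ℤ) : ℝ)| ≤ 1 / 3)
    (z : Fin n → ℤˣ) (x : (Fin n × Fin m) × Fin N → ℤˣ) :
    |∑ V, c V * cubeChar V x - ((f z : ℤ) : ℝ)|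
      ≤ 1 / 3 + 2 * ∑ i, (if innerValue x i ≠ z i then 1 else 0)
        + 3 * (4 * T : ℝ) ^ D * Real.exp (-(N / (2 * T))) * Real.exp ((hammingWeight x : ℝ) / T) := by
  have hT' : (1 : ℝ) ≤ T := by exact_mod_cast hT
  have hs0 : (0 : ℝ) ≤ ∑ i, (if innerValue x i ≠ z i then 1 else 0) :=
    sum_nonneg fun i _ => by split_ifs <;> norm_num
  have he0 : 0 ≤ 3 * (4 * T : ℝ) ^ D * Real.exp (-(N / (2 * T)))
      * Real.exp ((hammingWeight x : ℝ) / T) := by positivity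
  rcases le_or_gt (hammingWeight x) N with hx | hx
  · have h1 := hf x hx
    by_cases hz : innerValue x = z
    · rw [hz] at h1
      linarith
    · obtain ⟨i, hi⟩ := Function.ne_iff.mp hz
      have h2 : (1 : ℝ) ≤ ∑ i, (if innerValue x i ≠ z i then 1 else 0) := by
        refine le_trans (le_of_eq (if_pos hi).symm) (single_le_sum
          (f := fun i => if innerValue x i ≠ z i then (1 : ℝ) else 0)
          (fun j _ => by split_ifs <;> norm_num) (mem_univ i))
      have h3 := abs_le.mp h1
      have h4 := abs_le.mp (abs_units_cast (f z)).le
      have h5 := abs_le.mp (abs_units_cast (f (innerValue x))).le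
      rw [abs_le]
      constructor <;> linarith
  · have hK : ∀ x : (Fin n × Fin m) × Fin N → ℤˣ, hammingWeight x ≤ D →
        |∑ V, c V * cubeChar V x| ≤ 4 / 3 := by
      intro x hx
      have h3 := abs_le.mp (hf x (hx.trans hDN))
      have h5 := abs_le.mp (abs_units_cast (f (innerValue x))).le
      rw [abs_le]
      constructor <;> linarith
    have h1 := abs_sum_cubeChar_le c D hc (4 / 3) hK (4 * T : ℝ)⁻¹ (by positivity)
      (inv_le_one_of_one_le₀ (by linarith)) x
    rw [inv_inv] at h1
    have h2 : (1 + 2 * (4 * T : ℝ)⁻¹) ^ hammingWeight x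
        ≤ Real.exp (-(N / (2 * T))) * Real.exp ((hammingWeight x : ℝ) / T) := by
      calc _ ≤ Real.exp (2 * (4 * T : ℝ)⁻¹) ^ hammingWeight x := by
            gcongr
            rw [add_comm]
            exact Real.add_one_le_exp _
        _ = Real.exp (hammingWeight x / (2 * T)) := by
            rw [← Real.exp_nat_mul]
            congr 1
            field_simp
            norm_num
        _ ≤ _ := by
            rw [← Real.exp_add, Real.exp_le_exp]
            have : (N : ℝ) / (2 * T) ≤ hammingWeight x / (2 * T) := by gcongr
            have e : (hammingWeight x : ℝ) / T = hammingWeight x / (2 * T)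
              + hammingWeight x / (2 * T) := by field_simp; norm_num
            linarith
    have h3 : (1 : ℝ) ≤ (4 * T : ℝ) ^ D * (1 + 2 * (4 * T : ℝ)⁻¹) ^ hammingWeight x := by
      refine one_le_mul_of_one_le_of_one_le (one_le_pow₀ (by linarith)) (one_le_pow₀ ?_)
      have : (0 : ℝ) ≤ 2 * (4 * T : ℝ)⁻¹ := by positivity
      linarith
    have h4 : (4 * T : ℝ) ^ D * (1 + 2 * (4 * T : ℝ)⁻¹) ^ hammingWeight x ≤ (4 * T : ℝ) ^ D *
        (Real.exp (-(N / (2 * T))) * Real.exp ((hammingWeight x : ℝ) / T)) := by gcongr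
    calc _ ≤ |∑ V, c V * cubeChar V x| + |((f z : ℤ) : ℝ)| := abs_sub _ _
      _ ≤ 3 * ((4 * T : ℝ) ^ D *
          (Real.exp (-(N / (2 * T))) * Real.exp ((hammingWeight x : ℝ) / T))) := by
        rw [abs_units_cast]
        linarith
      _ ≤ _ := by linarith

/-! ### The lower bound -/

theorem approxDegree_le_totalDegree {ι : Type*} {X : Set (ι → ℤˣ)} {ε : ℝ} {f : X → ℤˣ}
    {p : MvPolynomial ι ℝ} (hp : IsApproxPoly ε f p) : approxDegree ε f ≤ p.totalDegree :=
  Nat.sInf_le ⟨p, rfl, hp⟩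

/-- Composing with `v ↦ v (3 - v²) / 2` reduces the error `2/5` to `1/3`. -/
theorem approxDegree_third_le {ι : Type*} {X : Set (ι → ℤˣ)} {f : X → ℤˣ}
    {p : MvPolynomial ι ℝ} (hp : IsApproxPoly (2 / 5) f p) :
    approxDegree (1 / 3) f ≤ 3 * p.totalDegree := by
  have h : IsApproxPoly (1 / 3) f (MvPolynomial.C (1 / 2) * (p * (MvPolynomial.C 3 - p ^ 2))) := by
    intro x
    have hx := abs_le.mp (hp x)
    simp only [map_mul, map_sub, map_pow, MvPolynomial.eval_C]
    generalize MvPolynomial.eval (realPoint x.1) p = v at hx ⊢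
    rw [abs_le]
    rcases Int.units_eq_one_or (f x) with h | h <;> rw [h] at hx ⊢ <;> push_cast at hx ⊢
    -- The cubic takes 1+u to 1 - (3/2)u² - u³/2, with error at most 0.272 for |u| ≤ 2/5.
    · obtain ⟨u, rfl⟩ : ∃ u, v = 1 + u := ⟨v - 1, by ring⟩
      have hu : u ^ 2 ≤ 4 / 25 := by nlinarith
      constructor <;> nlinarith [sq_nonneg u]
    · obtain ⟨u, rfl⟩ : ∃ u, v = -1 + u := ⟨v + 1, by ring⟩
      have hu : u ^ 2 ≤ 4 / 25 := by nlinarith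
      constructor <;> nlinarith [sq_nonneg u]
  refine (approxDegree_le_totalDegree h).trans ?_
  refine (MvPolynomial.totalDegree_mul _ _).trans ?_
  rw [MvPolynomial.totalDegree_C, zero_add]
  refine (MvPolynomial.totalDegree_mul _ _).trans ?_
  have h1 : (MvPolynomial.C 3 - p ^ 2).totalDegree ≤ 2 * p.totalDegree := by
    refine (MvPolynomial.totalDegree_sub _ _).trans (max_le (by simp) ?_)
    exact MvPolynomial.totalDegree_pow _ _
  omega

open Finset in
theorem approxDegree_le_card {ι : Type*} [Fintype ι] {X : Set (ι → ℤˣ)} {ε : ℝ} (hε : 0 ≤ ε)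
    (f : X → ℤˣ) : approxDegree ε f ≤ Fintype.card ι := by
  classical
  obtain ⟨p, -, hp⟩ := exists_isApproxPoly hε f
  obtain ⟨c, -, hc⟩ := exists_eval_eq_sum_cubeChar p
  have h : IsApproxPoly ε f (∑ V, MvPolynomial.C (c V) * ∏ b ∈ V, MvPolynomial.X b) := by
    intro x
    have := hp x
    rw [hc] at this
    simpa [cubeChar] using this
  refine (approxDegree_le_totalDegree h).trans ?_
  refine MvPolynomial.totalDegree_finsetSum_le fun V _ => ?_
  refine (MvPolynomial.totalDegree_mul _ _).trans ?_
  rw [MvPolynomial.totalDegree_C, zero_add]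
  refine (MvPolynomial.totalDegree_finsetProd _ _).trans ?_
  simpa using card_le_univ V

open Finset in
theorem approxDegree_mul_le {n m N k : ℕ} (hk : 1 ≤ k) (hkN : 100 * k ^ 2 ≤ N)
    (f : (Fin n → ℤˣ) → ℤˣ) (p : MvPolynomial ((Fin n × Fin m) × Fin N) ℝ)
    (hp : IsApproxPoly (1 / 3) (promiseComp f m N) p) (hpN : p.totalDegree ≤ N)
    (hnm : 40 * (n * m) ≤ N) (hm : 2 * n * (3 / 5 : ℝ) ^ m ≤ 1 / 30)
    (hexp : 3 * (4 * (100 * k ^ 2 : ℕ) : ℝ) ^ p.totalDegree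
      * Real.exp (-(N / (4 * (100 * k ^ 2 : ℕ)))) ≤ 1 / 30) :
    approxDegree (1 / 3) (onCube f) * k ≤ 3 * p.totalDegree := by
  obtain ⟨A, B, hA0, hB0, hA1, hB1, hAone, hBone, hAexp, hBexp, hAB⟩ :=
    exists_cube_distributions k N hk hkN
  set T := 100 * k ^ 2 with hTdef
  have hT : 0 < T := by positivity
  have hT' : (0 : ℝ) < T := by exact_mod_cast hT
  set D := p.totalDegree with hD
  let μ : ℤˣ → (Fin N → ℤˣ) → ℝ := fun s => if s = 1 then A else B
  have hμ1 : μ 1 = A := if_pos rfl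
  have hμ2 : μ (-1) = B := if_neg (by decide)
  have hall : ∀ Q : ((Fin N → ℤˣ) → ℝ) → Prop, Q A → Q B → ∀ s, Q (μ s) := by
    intro Q h1 h2 s
    rcases Int.units_eq_one_or s with rfl | rfl
    · rwa [hμ1]
    · rwa [hμ2]
  have hμ0 : ∀ s y, 0 ≤ μ s y := hall (fun ν => ∀ y, 0 ≤ ν y) hA0 hB0
  have hμs : ∀ s, ∑ y, μ s y = 1 := hall (fun ν => ∑ y, ν y = 1) hA1 hB1
  have hμe := hall (fun ν => ∑ y, ν y * Real.exp ((hammingWeight y : ℝ) / T)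
    ≤ Real.exp (10 / T)) hAexp hBexp
  obtain ⟨c, hc, hceval⟩ := exists_eval_eq_sum_cubeChar p
  obtain ⟨r, hrdeg, hr⟩ := exists_blockAverage_poly (n := n) (m := m) hk μ
    (by rw [hμ1, hμ2]; exact hAB) c hc
  have hf : ∀ x : (Fin n × Fin m) × Fin N → ℤˣ, hammingWeight x ≤ N →
      |∑ V, c V * cubeChar V x - ((f (innerValue x) : ℤ) : ℝ)| ≤ 1 / 3 := by
    intro x hx
    rw [← hceval]
    exact hp ⟨x, hx⟩
  have happ : IsApproxPoly (2 / 5) (onCube f) r := by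
    rintro ⟨z, -⟩
    have hw0 : ∀ x : (Fin n × Fin m) × Fin N → ℤˣ, 0 ≤ blockDist μ z x :=
      fun x => prod_nonneg fun a _ => hμ0 _ _
    have hw1 := sum_blockDist (m := m) μ hμs z
    set E := 3 * (4 * T : ℝ) ^ D * Real.exp (-(N / (2 * T))) with hE
    have hE0 : 0 ≤ E := by positivity
    change |MvPolynomial.eval (realPoint z) r - ((f z : ℤ) : ℝ)| ≤ 2 / 5
    calc |MvPolynomial.eval (realPoint z) r - ((f z : ℤ) : ℝ)|
        = |∑ x, blockDist μ z x * (∑ V, c V * cubeChar V x - ((f z : ℤ) : ℝ))| := by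
          simp_rw [mul_sub]
          rw [sum_sub_distrib, ← sum_mul, hw1, one_mul, hr z]
      _ ≤ ∑ x, blockDist μ z x * (1 / 3 + 2 * ∑ i, (if innerValue x i ≠ z i then 1 else 0)
            + E * Real.exp ((hammingWeight x : ℝ) / T)) := by
          refine (abs_sum_le_sum_abs _ _).trans (sum_le_sum fun x _ => ?_)
          rw [abs_mul, abs_of_nonneg (hw0 x)]
          exact mul_le_mul_of_nonneg_left (abs_eval_sub_le hT hpN f c hc hf z x) (hw0 x)
      _ = 1 / 3 + 2 * ∑ i, ∑ x, blockDist μ z x * (if innerValue x i ≠ z i then 1 else 0)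
            + E * ∑ x, blockDist μ z x * Real.exp ((hammingWeight x : ℝ) / T) := by
          simp_rw [mul_add]
          rw [sum_add_distrib, sum_add_distrib, ← sum_mul, hw1, one_mul, mul_sum univ _ E,
            sum_comm, mul_sum univ _ (2 : ℝ)]
          congr 1
          · congr 1
            refine sum_congr rfl fun x _ => ?_
            rw [← mul_sum]
            ring
          · exact sum_congr rfl fun x _ => by ring
      _ ≤ 1 / 3 + 2 * (n * (3 / 5 : ℝ) ^ m) + E * Real.exp (n * m * (10 / T)) := by
          gcongr
          · refine (sum_le_sum fun i _ => sum_blockDist_innerValue_ne_le μ hμ0 hμs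
              (by rw [hμ1]; exact hAone) (by rw [hμ2]; exact hBone) z i).trans (le_of_eq ?_)
            simp
          · exact sum_blockDist_mul_exp_le μ hμ0 T (10 / T) hμe z
      -- Half of the exponent N/(2T) absorbs the exponential moment 10nm/T, by 40nm ≤ N.
      _ ≤ 1 / 3 + 2 * (n * (3 / 5 : ℝ) ^ m)
            + 3 * (4 * T : ℝ) ^ D * Real.exp (-(N / (4 * T))) := by
          refine add_le_add le_rfl ?_
          rw [hE, mul_assoc, ← Real.exp_add]
          gcongr
          have h1 : (n * m * (10 / T) : ℝ) ≤ N / (4 * T) := by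
            rw [le_div_iff₀ (by positivity)]
            calc (n * m * (10 / T) * (4 * T) : ℝ) = 40 * (n * m) := by field_simp; ring
              _ ≤ N := by exact_mod_cast hnm
          have h2 : (N / (2 * T) : ℝ) = N / (4 * T) + N / (4 * T) := by field_simp; ring
          linarith
      _ ≤ 2 / 5 := by linarith
  have h1 := approxDegree_third_le happ
  calc _ ≤ 3 * r.totalDegree * k := Nat.mul_le_mul_right k h1
    _ ≤ _ := by rw [mul_assoc]; exact Nat.mul_le_mul_left 3 hrdeg

/-! ### Numerical estimates and the choice of parameters -/

theorem exists_cbrt {x : ℝ} (hx : 1 ≤ x) :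
    ∃ a : ℝ, 1 ≤ a ∧ a ^ 3 = x ∧ x ^ (1 / 3 : ℝ) = a ∧ x ^ (2 / 3 : ℝ) = a ^ 2 := by
  have h0 : 0 ≤ x := by linarith
  refine ⟨x ^ (1 / 3 : ℝ), Real.one_le_rpow hx (by norm_num), ?_, rfl, ?_⟩
  · rw [← Real.rpow_natCast, ← Real.rpow_mul h0]
    norm_num
  · rw [← Real.rpow_natCast, ← Real.rpow_mul h0]
    norm_num

/-- Since (3/5)^10 ≤ 2⁻⁷, the power is at most n⁻⁷, and 2n⁻⁶ ≤ 1/32. -/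
theorem two_mul_mul_pow_ceil_le (n : ℕ) (hn : 2 ≤ n) :
    2 * n * (3 / 5 : ℝ) ^ ⌈10 * Real.logb 2 n⌉₊ ≤ 1 / 30 := by
  have hn' : (2 : ℝ) ≤ n := by exact_mod_cast hn
  have hn0 : (0 : ℝ) < n := by linarith
  have hL : 0 ≤ Real.logb 2 n := Real.logb_nonneg (by norm_num) (by linarith)
  have h1 : (3 / 5 : ℝ) ^ ⌈10 * Real.logb 2 n⌉₊ ≤ ((n : ℝ) ^ 7)⁻¹ := by
    calc (3 / 5 : ℝ) ^ ⌈10 * Real.logb 2 n⌉₊ = (3 / 5 : ℝ) ^ ((⌈10 * Real.logb 2 n⌉₊ : ℕ) : ℝ) :=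
          (Real.rpow_natCast _ _).symm
      _ ≤ (3 / 5 : ℝ) ^ (10 * Real.logb 2 n) :=
          Real.rpow_le_rpow_of_exponent_ge (by norm_num) (by norm_num) (Nat.le_ceil _)
      _ = ((3 / 5 : ℝ) ^ 10) ^ Real.logb 2 n := by
          rw [Real.rpow_mul (by norm_num)]
          norm_num
      _ ≤ ((2 : ℝ) ^ (-7 : ℝ)) ^ Real.logb 2 n := by
          refine Real.rpow_le_rpow (by norm_num) ?_ hL
          rw [Real.rpow_neg (by norm_num)]
          norm_num
      _ = ((n : ℝ) ^ 7)⁻¹ := by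
          rw [← Real.rpow_mul (by norm_num), mul_comm, Real.rpow_mul (by norm_num),
            Real.rpow_logb (by norm_num) (by norm_num) hn0, Real.rpow_neg hn0.le]
          norm_num
  calc 2 * n * (3 / 5 : ℝ) ^ ⌈10 * Real.logb 2 n⌉₊ ≤ 2 * n * ((n : ℝ) ^ 7)⁻¹ := by gcongr
    _ = 2 / (n : ℝ) ^ 6 := by field_simp
    _ ≤ 2 / 2 ^ 6 := by gcongr
    _ ≤ 1 / 30 := by norm_num

theorem three_mul_pow_mul_exp_le {S R : ℝ} (hS : 1 ≤ S) (D : ℕ) (h : D * Real.log S + 5 ≤ R) :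
    3 * S ^ D * Real.exp (-R) ≤ 1 / 30 := by
  have h1 : S ^ D = Real.exp (D * Real.log S) := by
    rw [Real.exp_nat_mul, Real.exp_log (by linarith)]
  have h2 : (90 : ℝ) ≤ Real.exp 5 := by
    have h3 : Real.exp 5 = Real.exp 1 ^ 5 := by rw [← Real.exp_nat_mul]; norm_num
    rw [h3]
    calc (90 : ℝ) ≤ 2.7 ^ 5 := by norm_num
      _ ≤ _ := by
        gcongr
        linarith [Real.exp_one_gt_d9]
  rw [h1, mul_assoc, ← Real.exp_add]
  calc 3 * Real.exp (D * Real.log S + -R) ≤ 3 * Real.exp (-5) := by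
        gcongr
        linarith
    _ ≤ 3 * (90 : ℝ)⁻¹ := by
        rw [Real.exp_neg]
        gcongr
    _ = 1 / 30 := by norm_num

theorem mainTheorem4 :
    ∃ c₀ : ℝ, 0 < c₀ ∧ ∀ c : ℝ, c₀ ≤ c → ∀ n : ℕ, 2 ≤ n → ∀ f : (Fin n → ℤˣ) → ℤˣ,
      (n : ℝ) ^ (1 / 3 : ℝ) * (approxDegree (1 / 3) (onCube f) : ℝ) ^ (2 / 3 : ℝ) ≤
        (approxDegree (1 / 3)
          (promiseComp f ⌈10 * Real.logb 2 n⌉₊ ⌈c * n * Real.logb 2 n ^ 3⌉₊) : ℝ) := by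
  -- The largest demand on N is 64000·nL + 32000·n with L = log₂ n, from the tail estimate at the
  -- end; L³ is used only through L³ ≥ L.
  refine ⟨100000, by norm_num, fun c hc n hn f => ?_⟩
  have hm := two_mul_mul_pow_ceil_le n hn
  have hn' : (2 : ℝ) ≤ n := by exact_mod_cast hn
  have hn0 : (0 : ℝ) < n := by linarith
  have hlog2 := Real.log_two_lt_d9
  have hlog2' : 0 < Real.log 2 := Real.log_pos (by norm_num)
  have hLlog : Real.logb 2 n * Real.log 2 = Real.log n := by
    rw [Real.logb, div_mul_cancel₀ _ hlog2'.ne']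
  have hL : 1 ≤ Real.logb 2 n := by
    rw [Real.le_logb_iff_rpow_le (by norm_num) hn0]
    simpa using hn'
  have hm11 : (⌈10 * Real.logb 2 n⌉₊ : ℝ) ≤ 11 * Real.logb 2 n := by
    have := Nat.ceil_lt_add_one (show 0 ≤ 10 * Real.logb 2 n by linarith)
    linarith
  have hN : 100000 * (n * Real.logb 2 n) ≤ (⌈c * n * Real.logb 2 n ^ 3⌉₊ : ℝ) := by
    refine le_trans ?_ (Nat.le_ceil _)
    have h1 : Real.logb 2 n ≤ Real.logb 2 n ^ 3 := le_self_pow₀ hL (by norm_num)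
    calc 100000 * (n * Real.logb 2 n) ≤ c * (n * Real.logb 2 n ^ 3) := by gcongr
      _ = _ := by ring
  generalize Real.logb 2 n = L at *
  generalize ⌈10 * L⌉₊ = m at *
  generalize ⌈c * n * L ^ 3⌉₊ = N at *
  rcases Nat.eq_zero_or_pos (approxDegree (1 / 3) (onCube f)) with hd | hd
  · rw [hd, Nat.cast_zero, Real.zero_rpow (by norm_num), mul_zero]
    exact Nat.cast_nonneg _
  have hdn : approxDegree (1 / 3) (onCube f) ≤ n := by
    simpa using approxDegree_le_card (by norm_num) (onCube f)
  obtain ⟨p, hpdeg, hp⟩ := exists_isApproxPoly (ε := 1 / 3) (by norm_num) (promiseComp f m N)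
  rw [← hpdeg]
  by_contra hcon
  push Not at hcon
  have hmain := fun k hk hkN hpN hnm hexp =>
    approxDegree_mul_le (k := k) hk hkN f p hp hpN hnm hm hexp
  generalize approxDegree (1 / 3) (onCube f) = d at *
  generalize p.totalDegree = D at *
  obtain ⟨e, he1, he3, he, -⟩ := exists_cbrt (x := n) (by linarith)
  obtain ⟨a, ha1, ha3, -, ha⟩ := exists_cbrt (x := d) (by exact_mod_cast hd)
  rw [he, ha] at hcon
  have hae : a ≤ e := by
    refine le_of_pow_le_pow_left₀ three_ne_zero (by linarith) ?_
    rw [ha3, he3]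
    exact_mod_cast hdn
  have ha0 : 0 < a := by linarith
  -- With e = n^{1/3} and a = d^{1/3}, the least k for which dk ≥ 3ea²; a ≤ e bounds the rounding
  -- loss, giving ka ≤ 4e.
  set k := ⌈3 * e / a⌉₊ with hk
  have hk1 : 3 * e ≤ k * a := by
    rw [← div_le_iff₀ ha0]
    exact Nat.le_ceil _
  have hk2 : k * a ≤ 4 * e := by
    have h1 := Nat.ceil_lt_add_one (show 0 ≤ 3 * e / a by positivity)
    rw [← hk] at h1
    have h2 : (k : ℝ) * a ≤ (3 * e / a + 1) * a := by gcongr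
    rw [add_mul, div_mul_cancel₀ _ ha0.ne'] at h2
    linarith
  have hkpos : 1 ≤ k := Nat.ceil_pos.mpr (by positivity)
  have hTa : ((100 * k ^ 2 : ℕ) : ℝ) * a ^ 2 ≤ 1600 * e ^ 2 := by
    push_cast
    nlinarith [mul_self_le_mul_self (by positivity : 0 ≤ k * a) hk2]
  have hDn : (D : ℝ) ≤ n := by
    rw [← he3]
    calc (D : ℝ) ≤ e * a ^ 2 := hcon.le
      _ ≤ e * e ^ 2 := by gcongr
      _ = e ^ 3 := by ring
  have hTn : ((100 * k ^ 2 : ℕ) : ℝ) ≤ 1600 * n := by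
    rw [← he3]
    calc ((100 * k ^ 2 : ℕ) : ℝ) ≤ ((100 * k ^ 2 : ℕ) : ℝ) * a ^ 2 :=
          le_mul_of_one_le_right (by positivity) (one_le_pow₀ ha1)
      _ ≤ 1600 * e ^ 2 := hTa
      _ ≤ 1600 * e ^ 3 := by
          gcongr
          norm_num
  have hTD : ((100 * k ^ 2 : ℕ) : ℝ) * D ≤ 1600 * n := by
    rw [← he3]
    calc ((100 * k ^ 2 : ℕ) : ℝ) * D ≤ ((100 * k ^ 2 : ℕ) : ℝ) * (e * a ^ 2) := by gcongr
      _ = (((100 * k ^ 2 : ℕ) : ℝ) * a ^ 2) * e := by ring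
      _ ≤ 1600 * e ^ 2 * e := by gcongr
      _ = 1600 * e ^ 3 := by ring
  have hTpos : (1 : ℝ) ≤ ((100 * k ^ 2 : ℕ) : ℝ) := by
    have : 1 ≤ k ^ 2 := Nat.one_le_pow _ _ hkpos
    exact_mod_cast (by omega : 1 ≤ 100 * k ^ 2)
  have hnL : (n : ℝ) ≤ n * L := le_mul_of_one_le_right hn0.le hL
  have hdk := hmain k hkpos
    (by exact_mod_cast (by linarith : ((100 * k ^ 2 : ℕ) : ℝ) ≤ N))
    (by exact_mod_cast (by linarith : (D : ℝ) ≤ N))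
    (by
      have : (n : ℝ) * m ≤ n * (11 * L) := by gcongr
      exact_mod_cast (by linarith : 40 * ((n : ℝ) * m) ≤ N))
    (by
      generalize ((100 * k ^ 2 : ℕ) : ℝ) = T at *
      refine three_mul_pow_mul_exp_le (by linarith) D ?_
      have hlog : Real.log (4 * T) ≤ 10 * L := by
        calc Real.log (4 * T) ≤ Real.log (2 ^ 13 * n) :=
              Real.log_le_log (by linarith) (by linarith)
          _ = 13 * Real.log 2 + L * Real.log 2 := by
              rw [Real.log_mul (by norm_num) hn0.ne', Real.log_pow, hLlog]
              norm_num
          _ ≤ 10 * L := by nlinarith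
      rw [le_div_iff₀ (by linarith)]
      calc (D * Real.log (4 * T) + 5) * (4 * T) ≤ (D * (10 * L) + 5) * (4 * T) := by gcongr
        _ = 40 * (T * D) * L + 20 * T := by ring
        _ ≤ 40 * (1600 * n) * L + 20 * (1600 * n) := by gcongr
        _ ≤ N := by linarith)
  have hdk' : (d : ℝ) * k ≤ 3 * D := by exact_mod_cast hdk
  have : 3 * (e * a ^ 2) ≤ d * k := by
    rw [← ha3]
    calc 3 * (e * a ^ 2) = 3 * e * a ^ 2 := by ring
      _ ≤ k * a * a ^ 2 := by gcongr
      _ = a ^ 3 * k := by ring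
  linarith
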